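/- Let $\sigma(x)=\max\{0,x\}$ and let $d\ge 1$. For integers $N,L$ let $\mathcal{NN}(N,L)$ be the set of functions $\mathbb{R}^d\to\mathbb{R}$ of the form $T_\ell\circ\sigma\circ T_{\ell-1}\circ\cdots\circ\sigma\circ T_1$ with $2\le \ell\le L$, where $\sigma$ acts coordinatewise, each $T_i:\mathbb{R}^{N_{i-1}}\to\mathbb{R}^{N_i}$ is affine, $N_0=d$, $N_\ell=1$ and $\max\{N_1,\dots,N_{\ell-1}\}\le N$ (networks of width at most $N$ and depth at most $L$). For a set $\mathcal{H}$ of functions and a norm $\|\cdot\|_{\mathcal B}$ write $\mathcal{E}(f,\mathcal{H};\mathcal{B})=\inf_{h\in\mathcal{H}}\|f-h\|_{\mathcal{B}}$. For quantities depending on $(N,L)$, the relation $A(N,L)=\mathcal{O}(R(N,L))$ means that there are constants $C,K>0$ with $A(N,L)\le C\,R(N,L)$ for all integers $N,L\ge K$. Let $\varphi:\mathbb{R}^d\to\mathbb{R}$ be continuous with compact support, and let $\alpha>0$. Suppose that the approximation order of $\varphi$ by neural networks is at least $\alpha$, that is, \[ \mathcal{E}(\varphi,\mathcal{NN}(N,L);L^\infty(\mathbb{R}^d))=\mathcal{O}\big((NL)^{-\alpha}\big).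 \] For an integer $j\ge 0$ and $M>0$ let $\mathcal{S}_j(\varphi,M)$ be the set of all functions $x\mapsto\sum_{n\in\mathbb{Z}^d}c_n\varphi(2^jx-n)$, where only finitely many $c_n\in\mathbb{R}$ are nonzero and $|c_n|<M$ for all $n$. Let $1\le p\le\infty$, $M>0$, $\beta>0$, and let $f:\mathbb{R}^d\to\mathbb{R}$ be a function whose restriction to $[0,1]^d$ is in $L^p([0,1]^d)$ and which satisfies \[ \mathcal{E}(f,\mathcal{S}_j(\varphi,M);L^p([0,1]^d))=\mathcal{O}(2^{-\beta j})\qquad (j\to\infty). \] Then \[ \mathcal{E}(f,\mathcal{NN}(N,L);L^p([0,1]^d))=\mathcal{O}\left(\max\left\{(NL)^{-\alpha},\ \left(\frac{NL}{\log_2N\,\log_2L}\right)^{-2\beta/d}\right\}\right). \] -/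

import Mathlib

open MeasureTheory
open scoped ENNReal Matrix

noncomputable section

/-- A fully connected feed-forward ReLU network with input dimension `n` and output dimension `m`:
a (possibly empty) list of hidden layers `x ↦ σ (A x + b)`, followed by an affine output layer. -/
inductive ReLUNet : ℕ → ℕ → Type
  | output {n m : ℕ} (A : Matrix (Fin m) (Fin n) ℝ) (b : Fin m → ℝ) : ReLUNet n m
  | hidden {n k m : ℕ} (A : Matrix (Fin k) (Fin n) ℝ) (b : Fin k → ℝ) (rest : ReLUNet k m) :
      ReLUNet n m

namespace ReLUNet

/-- The function represented by a network, `T_L (σ (T_{L-1} (⋯ σ (T_1 x) ⋯)))`. -/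
def eval : {n m : ℕ} → ReLUNet n m → (Fin n → ℝ) → (Fin m → ℝ)
  | _, _, output A b, x => A *ᵥ x + b
  | _, _, hidden A b rest, x => rest.eval (fun i => max 0 ((A *ᵥ x + b) i))

/-- The depth: the number of affine maps. -/
def depth : {n m : ℕ} → ReLUNet n m → ℕ
  | _, _, output _ _ => 1
  | _, _, hidden _ _ rest => rest.depth + 1

/-- The width: the largest number of units in a hidden layer. -/
def width : {n m : ℕ} → ReLUNet n m → ℕ
  | _, _, output _ _ => 0
  | _, _, hidden (k := k) _ _ rest => max k rest.width

end ReLUNet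

/-- `NN(N, L)`: the real functions on `ℝ^d` represented by ReLU networks of width at most `N` and
depth at most `L` (the depth of a network being at least `2`). -/
def reluClass (d N L : ℕ) : Set ((Fin d → ℝ) → ℝ) :=
  {f | ∃ net : ReLUNet d 1, 2 ≤ net.depth ∧ net.depth ≤ L ∧ net.width ≤ N ∧
    ∀ x, f x = net.eval x 0}

/-- `S_j(φ, M)`: the finite linear combinations `∑ₙ cₙ φ(2^j x - n)`, `n ∈ ℤ^d`, whose
coefficients all satisfy `|cₙ| < M`. -/
def shiftSpace {d : ℕ} (φ : (Fin d → ℝ) → ℝ) (j : ℕ) (M : ℝ) : Set ((Fin d → ℝ) → ℝ) :=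
  {g | ∃ c : (Fin d → ℤ) →₀ ℝ, (∀ n, |c n| < M) ∧
    ∀ x, g x = c.sum fun n a => a * φ (fun i => 2 ^ j * x i - (n i : ℝ))}

/-- The approximation error `inf_{h ∈ H} ‖f - h‖` in the `L^p(μ)` norm, with values in `[0, ∞]`. -/
def approxError {d : ℕ} (f : (Fin d → ℝ) → ℝ) (H : Set ((Fin d → ℝ) → ℝ)) (p : ℝ≥0∞)
    (μ : Measure (Fin d → ℝ)) : ℝ≥0∞ :=
  ⨅ h ∈ H, eLpNorm (f - h) p μ

/-- Lebesgue measure on the cube `[0,1]^d`. -/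
def cubeMeasure (d : ℕ) : Measure (Fin d → ℝ) :=
  (volume : Measure (Fin d → ℝ)).restrict (Set.Icc 0 1)

/-- `E(N, L) = O(R(N, L))` for width `N` and depth `L`: there are constants `C, K > 0` such that
`E(N, L) ≤ C R(N, L)` for all integers `N, L ≥ K`. -/
def IsBigOWidthDepth (E : ℕ → ℕ → ℝ≥0∞) (R : ℕ → ℕ → ℝ) : Prop :=
  ∃ C : ℝ, 0 < C ∧ ∃ K : ℕ, 0 < K ∧ ∀ N L : ℕ, K ≤ N → K ≤ L →
    E N L ≤ ENNReal.ofReal (C * R N L)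

/-- The approximation order of `φ` by ReLU networks is at least `α`, in `L^∞(ℝ^d)`. -/
def ApproxOrderAtLeast {d : ℕ} (φ : (Fin d → ℝ) → ℝ) (α : ℝ) : Prop :=
  IsBigOWidthDepth (fun N L => approxError φ (reluClass d N L) ∞ volume)
    (fun N L => ((N : ℝ) * (L : ℝ)) ^ (-α))

end

/-! By hypothesis `f` is within `O(2^(-βj))` of some `∑ c_n φ(2^j x - n)`, so it suffices to emulate
such a sum on the cube by a network. With `K ~ N` and `T ~ L / log L`, a network of width `O(K)` and
depth `O(T log L)` can store `K² T²` coefficients. Taking `2^(jd)` of this order turns `2^(-βj)`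
into `(KT)^(-2β/d)`; this is the source of the exponent `2β/d`.

The shifts `n` are sorted by their residues mod `8R`, where `φ` is supported in `[-R, R]^d`. Within
one class the supports are disjoint, and each lies in the middle of a cell of a grid of mesh `4R`. A
triangle wave folds all cells onto one, so a single copy of the network for `φ` serves the whole
class, and its value `v` has to be multiplied by the coefficient of the current cell
(`exists_cell_product`). The `(8R)^d` classes are treated one after the other
(`exists_reluClass_approx_shifts`).

The multiplication (`exists_lookup_mul`) is digit extraction. The coefficients are written with `e`
digits in base `K`, and `T` of them are packed into one integer of a table with `T K²` entries. The
network finds the entry, peels off its digits, and multiplies each digit by `v` exactly, using unary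
gates. Since the base is about `N`, only `e ~ log L` digits are needed for accuracy `(NL)^(-α)`.

ReLU networks compute floors only away from the jumps. Near the jumps the folded `φ` vanishes, so
`v` is as small as the error of the network for `φ`; the product is clamped to `[-M|v|, M|v|]`, so a
wrong coefficient does no harm there. This gives a uniform bound on the whole cube, valid for every
`p`. -/

namespace ReLUNet

/-! ### Changing the output of a network -/

/-- Append a hidden layer after the output of a network. -/
def snoc : {n m : ℕ} → ReLUNet n m → (k : ℕ) → Matrix (Fin k) (Fin m) ℝ → (Fin k → ℝ) →
    ReLUNet n k
  | _, _, output A₀ b₀, _, A, b => hidden (A * A₀) (A *ᵥ b₀ + b) (output 1 0)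
  | _, _, hidden A₀ b₀ rest, k, A, b => hidden A₀ b₀ (rest.snoc k A b)

theorem eval_snoc {n m : ℕ} (net : ReLUNet n m) (k : ℕ) (A : Matrix (Fin k) (Fin m) ℝ)
    (b : Fin k → ℝ) (x : Fin n → ℝ) :
    (net.snoc k A b).eval x = fun i => max 0 ((A *ᵥ net.eval x + b) i) := by
  induction net with
  | output A₀ b₀ =>
    simp [snoc, eval, Matrix.mulVec_add, add_assoc]
  | hidden A₀ b₀ rest ih => simp [snoc, eval, ih]

theorem depth_snoc {n m : ℕ} (net : ReLUNet n m) (k : ℕ) (A : Matrix (Fin k) (Fin m) ℝ)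
    (b : Fin k → ℝ) : (net.snoc k A b).depth = net.depth + 1 := by
  induction net with
  | output A₀ b₀ => simp [snoc, depth]
  | hidden A₀ b₀ rest ih => simp [snoc, depth, ih]

theorem width_snoc {n m : ℕ} (net : ReLUNet n m) (k : ℕ) (A : Matrix (Fin k) (Fin m) ℝ)
    (b : Fin k → ℝ) : (net.snoc k A b).width = max net.width k := by
  induction net with
  | output A₀ b₀ => simp [snoc, width]
  | hidden A₀ b₀ rest ih => simp [snoc, width, ih, max_assoc]

theorem one_le_depth {n m : ℕ} (net : ReLUNet n m) : 1 ≤ net.depth := by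
  cases net <;> simp [depth]

/-- Apply an affine map to the output of a network. -/
def mapOutput : {n m : ℕ} → ReLUNet n m → (k : ℕ) → Matrix (Fin k) (Fin m) ℝ → (Fin k → ℝ) →
    ReLUNet n k
  | _, _, output A₀ b₀, _, A, b => output (A * A₀) (A *ᵥ b₀ + b)
  | _, _, hidden A₀ b₀ rest, k, A, b => hidden A₀ b₀ (rest.mapOutput k A b)

theorem eval_mapOutput {n m : ℕ} (net : ReLUNet n m) (k : ℕ) (A : Matrix (Fin k) (Fin m) ℝ)
    (b : Fin k → ℝ) (x : Fin n → ℝ) :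
    (net.mapOutput k A b).eval x = A *ᵥ net.eval x + b := by
  induction net with
  | output A₀ b₀ => simp [mapOutput, eval, Matrix.mulVec_add, add_assoc]
  | hidden A₀ b₀ rest ih => simp [mapOutput, eval, ih]

theorem depth_mapOutput {n m : ℕ} (net : ReLUNet n m) (k : ℕ) (A : Matrix (Fin k) (Fin m) ℝ)
    (b : Fin k → ℝ) : (net.mapOutput k A b).depth = net.depth := by
  induction net with
  | output A₀ b₀ => simp [mapOutput, depth]
  | hidden A₀ b₀ rest ih => simp [mapOutput, depth, ih]

theorem width_mapOutput {n m : ℕ} (net : ReLUNet n m) (k : ℕ) (A : Matrix (Fin k) (Fin m) ℝ)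
    (b : Fin k → ℝ) : (net.mapOutput k A b).width = net.width := by
  induction net with
  | output A₀ b₀ => simp [mapOutput, width]
  | hidden A₀ b₀ rest ih => simp [mapOutput, width, ih]

theorem continuous_eval {n m : ℕ} (net : ReLUNet n m) : Continuous net.eval := by
  induction net with
  | output A b =>
    simp only [eval]
    exact (Continuous.matrix_mulVec continuous_const continuous_id).add continuous_const
  | hidden A b rest ih =>
    simp only [eval]
    refine ih.comp (continuous_pi fun i => continuous_const.max ?_)
    exact (continuous_apply i).comp
      ((Continuous.matrix_mulVec continuous_const continuous_id).add continuous_const)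

end ReLUNet

/-! ### Affine combinations of finite families of functions -/

section AffineSpan

variable {X : Type*}

/-- The affine combinations of a list of real functions. -/
def affSpan (C : List (X → ℝ)) : Submodule ℝ (X → ℝ) :=
  Submodule.span ℝ (insert (fun _ => 1) {g | g ∈ C})

variable {C C' : List (X → ℝ)} {f g : X → ℝ}

theorem affSpan_mem (h : g ∈ C) : g ∈ affSpan C :=
  Submodule.subset_span (Set.mem_insert_of_mem _ h)

theorem affSpan_const (c : ℝ) : (fun _ => c) ∈ affSpan C := by
  have h : (fun _ => (1 : ℝ)) ∈ affSpan C := Submodule.subset_span (Set.mem_insert _ _)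
  convert (affSpan C).smul_mem c h using 1
  ext; simp

theorem affSpan_add (hf : f ∈ affSpan C) (hg : g ∈ affSpan C) :
    (fun x => f x + g x) ∈ affSpan C := (affSpan C).add_mem hf hg

theorem affSpan_sub (hf : f ∈ affSpan C) (hg : g ∈ affSpan C) :
    (fun x => f x - g x) ∈ affSpan C := (affSpan C).sub_mem hf hg

theorem affSpan_neg (hf : f ∈ affSpan C) : (fun x => -f x) ∈ affSpan C :=
  (affSpan C).neg_mem hf

theorem affSpan_const_mul (c : ℝ) (hf : f ∈ affSpan C) : (fun x => c * f x) ∈ affSpan C :=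
  (affSpan C).smul_mem c hf

theorem affSpan_div_const (c : ℝ) (hf : f ∈ affSpan C) : (fun x => f x / c) ∈ affSpan C := by
  simpa [div_eq_inv_mul] using affSpan_const_mul c⁻¹ hf

theorem affSpan_sum {ι : Type*} (s : Finset ι) {F : ι → X → ℝ}
    (hF : ∀ i ∈ s, F i ∈ affSpan C) : (fun x => ∑ i ∈ s, F i x) ∈ affSpan C := by
  convert (affSpan C).sum_mem hF using 1
  ext; simp

theorem affSpan_le (h : ∀ g ∈ C', g ∈ affSpan C) : affSpan C' ≤ affSpan C := by
  refine Submodule.span_le.2 (Set.insert_subset (affSpan_const 1) h)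

theorem affSpan_mono (h : C' ⊆ C) : affSpan C' ≤ affSpan C :=
  affSpan_le fun _ hg => affSpan_mem (h hg)

theorem exists_of_mem_affSpan_ofFn {k : ℕ} {F : Fin k → X → ℝ}
    (h : g ∈ affSpan (List.ofFn F)) :
    ∃ (w : Fin k → ℝ) (c : ℝ), ∀ x, g x = ∑ i, w i * F i x + c := by
  induction h using Submodule.span_induction with
  | mem g hg =>
    rcases hg with rfl | hg
    · exact ⟨0, 1, by simp⟩
    · obtain ⟨i, rfl⟩ := (List.mem_ofFn' _ _).1 hg
      exact ⟨Pi.single i 1, 0, by simp [Pi.single_apply]⟩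
  | zero => exact ⟨0, 0, by simp⟩
  | add g g' _ _ h h' =>
    obtain ⟨w, c, h⟩ := h
    obtain ⟨w', c', h'⟩ := h'
    refine ⟨w + w', c + c', fun x => ?_⟩
    simp only [Pi.add_apply, h, h', add_mul, Finset.sum_add_distrib]
    ring
  | smul a g _ h =>
    obtain ⟨w, c, h⟩ := h
    refine ⟨a • w, a * c, fun x => ?_⟩
    simp only [Pi.smul_apply, smul_eq_mul, h, mul_add, Finset.mul_sum, mul_assoc]

end AffineSpan

/-! ### A calculus for building networks layer by layer -/

/-- The functions in the list `C` are affine combinations of the outputs of one network of width at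
most `W` and depth at most `D`. -/
def Realizable (d W D : ℕ) (C : List ((Fin d → ℝ) → ℝ)) : Prop :=
  ∃ (k : ℕ) (net : ReLUNet d k), net.depth ≤ D ∧ net.width ≤ W ∧
    ∀ g ∈ C, g ∈ affSpan (List.ofFn fun (i : Fin k) x => net.eval x i)

namespace Realizable

variable {d W D : ℕ} {C C' : List ((Fin d → ℝ) → ℝ)}

theorem of_affSpan (h : Realizable d W D C) (h' : ∀ g ∈ C', g ∈ affSpan C) :
    Realizable d W D C' := by
  obtain ⟨k, net, hD, hW, hC⟩ := h
  exact ⟨k, net, hD, hW, fun g hg => affSpan_le hC (h' g hg)⟩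

theorem mono (h : Realizable d W D C) {D' : ℕ} (hD : D ≤ D') : Realizable d W D' C := by
  obtain ⟨k, net, hD', hW, hC⟩ := h
  exact ⟨k, net, hD'.trans hD, hW, hC⟩

theorem coords : Realizable d W 1 (List.ofFn fun (i : Fin d) x => x i) :=
  ⟨d, .output 1 0, by simp [ReLUNet.depth], by simp [ReLUNet.width], fun g hg => by
    simpa [ReLUNet.eval] using affSpan_mem hg⟩

/-- Consecutive affine maps merge, so affine combinations are free and only rectifications cost
depth. -/
theorem layer (h : Realizable d W D C) (H : List ((Fin d → ℝ) → ℝ))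
    (hH : ∀ h ∈ H, h ∈ affSpan C) (hW : H.length ≤ W) :
    Realizable d W (D + 1) (H.map fun h x => max 0 (h x)) := by
  obtain ⟨k, net, hD, hW', hC⟩ := h
  have key : ∀ i : Fin H.length, ∃ (w : Fin k → ℝ) (c : ℝ), ∀ x,
      H.get i x = ∑ j, w j * net.eval x j + c := fun i =>
    exists_of_mem_affSpan_ofFn (affSpan_le hC (hH _ (List.get_mem _ _)))
  choose w c hwc using key
  refine ⟨H.length, net.snoc H.length (Matrix.of w) c, ?_, ?_, ?_⟩
  · rw [ReLUNet.depth_snoc]; omega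
  · rw [ReLUNet.width_snoc]; exact max_le hW' hW
  · intro g hg
    obtain ⟨h, hh, rfl⟩ := List.mem_map.1 hg
    obtain ⟨i, rfl⟩ := List.get_of_mem hh
    refine affSpan_mem ((List.mem_ofFn' _ _).2 ⟨i, ?_⟩)
    ext x
    simp only [ReLUNet.eval_snoc, Pi.add_apply, hwc, Matrix.mulVec, dotProduct, Matrix.of_apply]

/-- One hidden layer, carrying the functions in `C'` along. -/
theorem step_carry (h : Realizable d W D C) (H : List ((Fin d → ℝ) → ℝ))
    (hH : ∀ h ∈ H, h ∈ affSpan C) (hC : ∀ g ∈ C', g ∈ affSpan C)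
    (hW : 2 * C'.length + H.length ≤ W) :
    Realizable d W (D + 1) ((H.map fun h x => max 0 (h x)) ++ C') := by
  have h1 := h.layer (H ++ (C' ++ C'.map fun g x => -g x)) ?_ ?_
  · refine h1.of_affSpan fun g hg => ?_
    rcases List.mem_append.1 hg with hg | hg
    · refine affSpan_mem ?_
      rw [List.map_append]
      exact List.mem_append_left _ hg
    · have e : g = fun x => max 0 (g x) - max 0 (-g x) := by
        ext x
        rcases le_total 0 (g x) with h0 | h0
        · rw [max_eq_right h0, max_eq_left (by linarith)]; ring
        · rw [max_eq_left h0, max_eq_right (by linarith)]; ring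
      rw [e]
      refine affSpan_sub (affSpan_mem ?_) (affSpan_mem ?_)
      · simp only [List.map_append, List.mem_append, List.mem_map]
        exact Or.inr (Or.inl ⟨g, hg, rfl⟩)
      · simp only [List.map_append, List.mem_append, List.mem_map]
        exact Or.inr (Or.inr ⟨fun x => -g x, ⟨g, hg, rfl⟩, rfl⟩)
  · intro g hg
    rcases List.mem_append.1 hg with hg | hg
    · exact hH g hg
    rcases List.mem_append.1 hg with hg | hg
    · exact hC g hg
    · obtain ⟨g, hg', rfl⟩ := List.mem_map.1 hg
      exact affSpan_neg (hC g hg')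
  · simp only [List.length_append, List.length_map]; omega

/-- A hidden layer, carrying all the available functions, followed by an affine change of the
available functions. -/
theorem step_to (h : Realizable d W D C) (H : List ((Fin d → ℝ) → ℝ))
    (hW : 2 * C.length + H.length ≤ W) (hH : ∀ h ∈ H, h ∈ affSpan C)
    (h' : ∀ g ∈ C', g ∈ affSpan ((H.map fun h x => max 0 (h x)) ++ C)) :
    Realizable d W (D + 1) C' :=
  (h.step_carry H hH (fun _ hg => affSpan_mem hg) hW).of_affSpan h'

/-- The additional layer writes `f` as `σ(f) - σ(-f)`; it guarantees the depth of at least `2` that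
`reluClass` demands. -/
theorem mem_reluClass {f : (Fin d → ℝ) → ℝ} (h : Realizable d W D [f]) (hW : 2 ≤ W) :
    f ∈ reluClass d W (D + 1) := by
  obtain ⟨k, net, hD, hW', hC⟩ := h
  obtain ⟨w, c, hwc⟩ := exists_of_mem_affSpan_ofFn (hC f (by simp))
  refine ⟨(net.snoc 2 (Matrix.of ![w, -w]) ![c, -c]).mapOutput 1 (Matrix.of ![![1, -1]]) 0,
    ?_, ?_, ?_, fun x => ?_⟩
  · rw [ReLUNet.depth_mapOutput, ReLUNet.depth_snoc]
    have := net.one_le_depth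
    omega
  · rw [ReLUNet.depth_mapOutput, ReLUNet.depth_snoc]; omega
  · rw [ReLUNet.width_mapOutput, ReLUNet.width_snoc]; exact max_le hW' hW
  · have hx := hwc x
    simp only [ReLUNet.eval_mapOutput, ReLUNet.eval_snoc, Pi.add_apply, Matrix.mulVec, dotProduct,
      Matrix.of_apply, Fin.sum_univ_two]
    simp only [Matrix.cons_val_zero, Matrix.cons_val_one, Pi.neg_apply, neg_mul,
      Finset.sum_neg_distrib, Pi.zero_apply, one_mul, add_zero]
    rw [← hx, ← neg_add, ← hx]
    rcases le_total 0 (f x) with h0 | h0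
    · rw [max_eq_right h0, max_eq_left (by linarith)]; ring
    · rw [max_eq_left h0, max_eq_right (by linarith)]; ring

/-- Run a network on some of the available functions, carrying the others along. -/
theorem comp_net {n m : ℕ} (net : ReLUNet n m) {D : ℕ} {r : Fin n → (Fin d → ℝ) → ℝ}
    (h : Realizable d W D (List.ofFn r ++ C)) (hW : net.width + 2 * C.length ≤ W) :
    Realizable d W (D + net.depth)
      (List.ofFn (fun (i : Fin m) x => net.eval (fun j => r j x) i) ++ C) := by
  induction net generalizing D with
  | output A b =>
    refine (h.of_affSpan ?_).mono (Nat.le_add_right _ _)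
    intro g hg
    rcases List.mem_append.1 hg with hg | hg
    · obtain ⟨i, rfl⟩ := (List.mem_ofFn' _ _).1 hg
      simp only [ReLUNet.eval, Pi.add_apply, Matrix.mulVec, dotProduct]
      refine affSpan_add (affSpan_sum _ fun j _ => affSpan_const_mul _ (affSpan_mem ?_))
        (affSpan_const _)
      exact List.mem_append_left _ ((List.mem_ofFn' _ _).2 ⟨j, rfl⟩)
    · exact affSpan_mem (List.mem_append_right _ hg)
  | @hidden n k m A b rest ih =>
    simp only [ReLUNet.width] at hW
    have hk := le_max_left k rest.width
    have hk' := le_max_right k rest.width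
    have h1 := h.step_carry (C' := C)
      (List.ofFn fun i x => (A *ᵥ (fun j => r j x) + b) i) ?_ ?_ ?_
    · rw [List.map_ofFn] at h1
      have h2 := ih (D := D + 1) (r := fun i x => max 0 ((A *ᵥ (fun j => r j x) + b) i)) h1
        (by omega)
      rw [add_assoc, add_comm 1] at h2
      exact h2
    · intro g hg
      obtain ⟨i, rfl⟩ := (List.mem_ofFn' _ _).1 hg
      simp only [Pi.add_apply, Matrix.mulVec, dotProduct]
      refine affSpan_add (affSpan_sum _ fun j _ => affSpan_const_mul _ (affSpan_mem ?_))
        (affSpan_const _)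
      exact List.mem_append_left _ ((List.mem_ofFn' _ _).2 ⟨j, rfl⟩)
    · exact fun g hg => affSpan_mem (List.mem_append_right _ hg)
    · rw [List.length_ofFn]; omega

end Realizable

/-! ### Floors and remainders away from the jumps -/

/-- The piecewise linear step from `0` to `1` on `[-1, 0]`. -/
noncomputable def ramp (z : ℝ) : ℝ := max 0 (z + 1) - max 0 z

theorem ramp_of_nonneg {z : ℝ} (h : 0 ≤ z) : ramp z = 1 := by
  rw [ramp, max_eq_right h, max_eq_right (by linarith)]; ring

theorem ramp_of_le {z : ℝ} (h : z ≤ -1) : ramp z = 0 := by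
  rw [ramp, max_eq_left (by linarith), max_eq_left (by linarith)]; ring

/-- Off the jumps, the ramps at the positive multiples of `c` are the unary expansion of `⌊z / c⌋`. -/
theorem ramp_eq_ite {c η z : ℝ} {m : ℕ} (hη : 0 < η) (hc : 0 ≤ c) (h₁ : m * c ≤ z)
    (h₂ : z ≤ m * c + c - η) (k : ℕ) :
    ramp ((z - (k + 1) * c) / η) = if k < m then 1 else 0 := by
  split_ifs with h
  · refine ramp_of_nonneg (div_nonneg ?_ hη.le)
    have : ((k : ℝ) + 1) ≤ m := by exact_mod_cast h
    nlinarith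
  · refine ramp_of_le ?_
    rw [div_le_iff₀ hη]
    have : (m : ℝ) ≤ k := by exact_mod_cast not_lt.1 h
    nlinarith

theorem sum_range_ite_lt {K m : ℕ} (h : m ≤ K) (a : ℝ) :
    ∑ k ∈ Finset.range K, (if k < m then a else 0) = m * a := by
  rw [← Finset.sum_filter]
  have : (Finset.range K).filter (· < m) = Finset.range m := by
    ext k; simp only [Finset.mem_filter, Finset.mem_range]; omega
  rw [this]; simp

section Membership

variable {X : Type*} {C C' : List (X → ℝ)} {z : X → ℝ}

/-- The preactivations of the ramps at `c, 2c, …, Kc`. -/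
noncomputable def ramps (K : ℕ) (c η : ℝ) (z : X → ℝ) : List (X → ℝ) :=
  ((List.range K).map fun (k : ℕ) x => (z x - (k + 1) * c) / η + 1) ++
    (List.range K).map fun (k : ℕ) x => (z x - (k + 1) * c) / η

theorem length_ramps (K : ℕ) (c η : ℝ) (z : X → ℝ) : (ramps K c η z).length = 2 * K := by
  simp [ramps, two_mul]

theorem mem_affSpan_of_mem_ramps {K : ℕ} {c η : ℝ} (hz : z ∈ affSpan C) :
    ∀ h ∈ ramps K c η z, h ∈ affSpan C := by
  intro h hh
  have key : ∀ k : ℕ, (fun x => (z x - (k + 1) * c) / η) ∈ affSpan C := fun k =>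
    affSpan_div_const _ (affSpan_sub hz (affSpan_const _))
  rcases List.mem_append.1 hh with hh | hh
  · obtain ⟨k, -, rfl⟩ := List.mem_map.1 hh
    exact affSpan_add (key k) (affSpan_const 1)
  · obtain ⟨k, -, rfl⟩ := List.mem_map.1 hh
    exact key k

theorem ramp_mem_affSpan {K : ℕ} {c η : ℝ}
    (h : ∀ h ∈ ramps K c η z, (fun x => max 0 (h x)) ∈ affSpan C) {k : ℕ} (hk : k < K) :
    (fun x => ramp ((z x - (k + 1) * c) / η)) ∈ affSpan C := by
  refine affSpan_sub (h (fun x => (z x - (k + 1) * c) / η + 1) ?_)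
    (h (fun x => (z x - (k + 1) * c) / η) ?_)
  · exact List.mem_append_left _ (List.mem_map.2 ⟨k, List.mem_range.2 hk, rfl⟩)
  · exact List.mem_append_right _ (List.mem_map.2 ⟨k, List.mem_range.2 hk, rfl⟩)

theorem abs_mem_affSpan (hz : z ∈ affSpan C) (h : (fun x => max 0 (z x)) ∈ affSpan C) :
    (fun x => |z x|) ∈ affSpan C := by
  convert affSpan_sub (affSpan_const_mul 2 h) hz using 1
  ext x
  rcases le_total 0 (z x) with h0 | h0
  · rw [max_eq_right h0, abs_of_nonneg h0]; ring
  · rw [max_eq_left h0, abs_of_nonpos h0]; ring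

theorem forall_mem_affSpan_cons {g : X → ℝ} (hg : g ∈ affSpan C) (h : ∀ g ∈ C', g ∈ affSpan C) :
    ∀ f ∈ g :: C', f ∈ affSpan C := List.forall_mem_cons.2 ⟨hg, h⟩

theorem relu_mem_affSpan_map {H : List (X → ℝ)} {h : X → ℝ} (hh : h ∈ H) :
    (fun x => max 0 (h x)) ∈ affSpan ((H.map fun h x => max 0 (h x)) ++ C) :=
  affSpan_mem (List.mem_append_left _ (List.mem_map.2 ⟨h, hh, rfl⟩))

theorem mem_affSpan_append_right {H : List (X → ℝ)} {h : X → ℝ} (hh : h ∈ C) :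
    h ∈ affSpan (H ++ C) :=
  affSpan_mem (List.mem_append_right _ hh)

end Membership

namespace Realizable

variable {d W D : ℕ} {C : List ((Fin d → ℝ) → ℝ)}

/-- Reduction modulo `c`, off the jumps, for values below `K ^ s * c`. -/
theorem exists_mod {K : ℕ} (s : ℕ) {c η : ℝ} (hη : 0 < η) (hηc : η ≤ c) {D : ℕ}
    {z : (Fin d → ℝ) → ℝ} (h : Realizable d W D (z :: C))
    (hW : 2 * (C.length + 1) + 2 * K ≤ W) :
    ∃ z', Realizable d W (D + s) (z' :: C) ∧ ∀ (x : Fin d → ℝ) (m : ℕ) (ρ : ℝ), 0 ≤ ρ →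
      ρ ≤ c - η → m < K ^ s → z x = m * c + ρ → z' x = ρ := by
  induction s generalizing z D with
  | zero =>
    refine ⟨z, h, fun x m ρ _ _ hm hz => ?_⟩
    have : m = 0 := by simpa using hm
    simpa [this] using hz
  | succ s ih =>
    -- One layer removes the leading base `K` digit of `m`, counted by the ramps at the multiples of
    -- `K ^ s * c`. What remains is `(m % K ^ s) * c + ρ`, at most `cp - η`, so the ramps are
    -- evaluated off their jumps.
    set cp : ℝ := K ^ s * c with hcp
    have h1 : Realizable d W (D + 1)
        ((fun x => z x - cp * ∑ k ∈ Finset.range K, ramp ((z x - (k + 1) * cp) / η)) :: C) := by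
      refine h.step_to (ramps K cp η z) ?_ (mem_affSpan_of_mem_ramps (affSpan_mem (by simp))) ?_
      · rw [length_ramps]; simpa using hW
      · refine forall_mem_affSpan_cons (affSpan_sub (mem_affSpan_append_right (by simp))
          (affSpan_const_mul _ (affSpan_sum _ fun k hk => ramp_mem_affSpan (fun _ hh =>
            relu_mem_affSpan_map hh) (Finset.mem_range.1 hk)))) ?_
        exact fun g hg => mem_affSpan_append_right (List.mem_cons_of_mem _ hg)
    obtain ⟨z', hz', hx⟩ := ih h1
    refine ⟨z', by rw [add_comm s, ← add_assoc]; exact hz', fun x m ρ h0 hρ hm hz => ?_⟩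
    have hK : 0 < K ^ s := by
      rcases Nat.eq_zero_or_pos (K ^ s) with h | h
      · rw [pow_succ, h] at hm; omega
      · exact h
    have hmod : m % K ^ s < K ^ s := Nat.mod_lt _ hK
    have hdiv : m / K ^ s < K := by rw [Nat.div_lt_iff_lt_mul hK, mul_comm, ← pow_succ]; exact hm
    have hm' : (m : ℝ) = (m / K ^ s : ℕ) * K ^ s + (m % K ^ s : ℕ) := by
      have := Nat.div_add_mod m (K ^ s)
      rw [mul_comm] at this
      exact_mod_cast this.symm
    refine hx x (m % K ^ s) ρ h0 hρ hmod ?_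
    have hmod' : ((m % K ^ s : ℕ) : ℝ) + 1 ≤ K ^ s := by exact_mod_cast hmod
    have hc : 0 < c := hη.trans_le hηc
    have hz1 : z x = (m / K ^ s : ℕ) * cp + ((m % K ^ s : ℕ) * c + ρ) := by
      rw [hz, hm', hcp]; ring
    have hramp := ramp_eq_ite (c := cp) (η := η) (z := z x) (m := m / K ^ s) hη
      (by positivity) (by rw [hz1]; have : 0 ≤ ((m % K ^ s : ℕ) : ℝ) * c := by positivity
                          linarith) (by rw [hz1]; nlinarith)
    simp only [hramp]
    rw [sum_range_ite_lt hdiv.le, hz1]; ring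

/-- Floor division by `c`, off the jumps, for values below `K ^ s * c`. -/
theorem exists_floor_div {K : ℕ} (s : ℕ) {c η : ℝ} (hη : 0 < η) (hηc : η ≤ c)
    (h : Realizable d W D C) {y : (Fin d → ℝ) → ℝ} (hy : y ∈ affSpan C)
    (hW : 2 * (C.length + 1) + 2 * K ≤ W) :
    ∃ f, Realizable d W (D + s) (f :: C) ∧ ∀ (x : Fin d → ℝ) (m : ℕ), m < K ^ s → m * c ≤ y x →
      y x ≤ m * c + (c - η) → f x = m := by
  obtain ⟨z, hz, hx⟩ := exists_mod (K := K) s hη hηc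
    (h.of_affSpan (forall_mem_affSpan_cons hy fun _ hg => affSpan_mem hg)) hW
  refine ⟨fun x => (y x - z x) / c, hz.of_affSpan (forall_mem_affSpan_cons ?_ ?_), ?_⟩
  · exact affSpan_div_const _ (affSpan_sub (affSpan_mono (List.subset_cons_self _ _) hy)
      (affSpan_mem (by simp)))
  · exact fun g hg => affSpan_mem (List.mem_cons_of_mem _ hg)
  · intro x m hm h1 h2
    have hc : 0 < c := hη.trans_le hηc
    simp only [hx x m (y x - m * c) (by linarith) (by linarith) hm (by ring)]
    rw [div_eq_iff hc.ne']; ring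

end Realizable

/-! ### Triangle waves -/

/-- The triangle wave with teeth of width one, up to `n + 1`. -/
noncomputable def toothWave (n : ℕ) (t : ℝ) : ℝ :=
  t + 2 * ∑ k ∈ Finset.range n, (-1) ^ (k + 1) * max 0 (t - (k + 1))

theorem toothWave_succ (n : ℕ) (t : ℝ) :
    toothWave (n + 1) t = toothWave n t + 2 * ((-1) ^ (n + 1) * max 0 (t - (n + 1))) := by
  simp only [toothWave, Finset.sum_range_succ]; ring

theorem toothWave_of_le (n : ℕ) {t : ℝ} (h : n ≤ t) :
    toothWave n t = if Even n then t - n else n + 1 - t := by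
  induction n with
  | zero => simp [toothWave]
  | succ n ih =>
    push_cast at h
    rw [toothWave_succ, ih (by linarith), max_eq_right (by linarith)]
    rcases Nat.even_or_odd n with hn | hn
    · rw [if_pos hn, if_neg (by simpa [Nat.even_add_one] using hn), Odd.neg_one_pow hn.add_one]
      push_cast; ring
    · rw [if_neg (by simpa using hn), if_pos hn.add_one, Even.neg_one_pow hn.add_one]
      push_cast; ring

/-- The slope flips between `1` and `-1` at each of `1, …, n`, so on `[0, n + 1]` the wave is the
distance to `2ℤ`. The integer `h` is kept explicit because the composition below needs to transform
it. -/
theorem exists_toothWave_eq (n : ℕ) {t : ℝ} (h₀ : 0 ≤ t) (h₁ : t ≤ n + 1) :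
    ∃ h : ℤ, toothWave n t = |t - 2 * h| ∧ |t - 2 * h| ≤ 1 := by
  rcases le_total (n : ℝ) t with h | h
  · rw [toothWave_of_le n h]
    rcases Nat.even_or_odd n with hn | hn
    · rw [if_pos hn]
      obtain ⟨k, rfl⟩ := hn
      push_cast at *
      refine ⟨k, ?_⟩
      push_cast
      rw [abs_of_nonneg (by linarith)]
      constructor <;> linarith
    · rw [if_neg (by simpa using hn)]
      obtain ⟨k, rfl⟩ := hn
      push_cast at *
      refine ⟨k + 1, ?_⟩
      push_cast
      rw [abs_of_nonpos (by linarith)]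
      constructor <;> linarith
  · induction n with
    | zero =>
      have : t = 0 := le_antisymm (by simpa using h) h₀
      exact ⟨0, by simp [toothWave, this]⟩
    | succ n ih =>
      push_cast at h
      rw [toothWave_succ, max_eq_left (by linarith), mul_zero, mul_zero, add_zero]
      rcases le_total (n : ℝ) t with h' | h'
      · rw [toothWave_of_le n h']
        rcases Nat.even_or_odd n with hn | hn
        · rw [if_pos hn]
          obtain ⟨k, rfl⟩ := hn
          push_cast at *
          refine ⟨k, ?_⟩
          push_cast
          rw [abs_of_nonneg (by linarith)]
          constructor <;> linarith
        · rw [if_neg (by simpa using hn)]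
          obtain ⟨k, rfl⟩ := hn
          push_cast at *
          refine ⟨k + 1, ?_⟩
          push_cast
          rw [abs_of_nonpos (by linarith)]
          constructor <;> linarith
      · exact ih h h'

namespace Realizable

variable {d W D : ℕ} {C : List ((Fin d → ℝ) → ℝ)}

/-- The triangle wave of period two, as a composition of triangle waves with few teeth. -/
theorem exists_triangleWave_aux {K : ℕ} (hK : 0 < K) (s : ℕ) {D : ℕ} {z : (Fin d → ℝ) → ℝ}
    (h : Realizable d W D (z :: C)) (hW : 2 * (C.length + 1) + K ≤ W) :
    ∃ z', Realizable d W (D + s) (z' :: C) ∧ ∀ (x : Fin d → ℝ) (y : ℝ),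
      (∃ h : ℤ, z x = |y - 2 * h| ∧ |y - 2 * h| ≤ 1) →
        ∃ h : ℤ, z' x = |K ^ s * y - 2 * h| ∧ |K ^ s * y - 2 * h| ≤ 1 := by
  induction s generalizing z D with
  | zero => exact ⟨z, h, fun x y hy => by simpa using hy⟩
  | succ s ih =>
    -- `K - 1` kinks suffice, since `K * z` stays in `[0, K]`.
    have h1 : Realizable d W (D + 1) ((fun x => toothWave (K - 1) (K * z x)) :: C) := by
      refine h.step_to ((List.range K).map fun (k : ℕ) x => K * z x - (k + 1)) ?_ ?_ ?_
      · simpa using hW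
      · intro g hg
        obtain ⟨k, -, rfl⟩ := List.mem_map.1 hg
        exact affSpan_sub (affSpan_const_mul _ (affSpan_mem (by simp))) (affSpan_const _)
      · refine forall_mem_affSpan_cons (affSpan_add (affSpan_const_mul _
          (mem_affSpan_append_right (by simp))) (affSpan_const_mul _ (affSpan_sum _ fun k hk =>
            affSpan_const_mul _ (relu_mem_affSpan_map (h := fun x => K * z x - (k + 1)) ?_)))) ?_
        · have := Finset.mem_range.1 hk
          exact List.mem_map.2 ⟨k, List.mem_range.2 (by omega), rfl⟩
        · exact fun g hg => mem_affSpan_append_right (List.mem_cons_of_mem _ hg)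
    obtain ⟨z', hz', hx⟩ := ih h1
    refine ⟨z', by rw [add_comm s, ← add_assoc]; exact hz', fun x y ⟨i, hi, hi1⟩ => ?_⟩
    have := hx x (K * y) ?_
    · rwa [pow_succ, mul_assoc]
    · have hK' : (0 : ℝ) < K := by exact_mod_cast hK
      obtain ⟨g, hg, hg1⟩ := exists_toothWave_eq (K - 1) (t := K * z x)
        (mul_nonneg hK'.le (hi ▸ abs_nonneg _)) (by
          rw [Nat.cast_sub hK, Nat.cast_one, hi, sub_add_cancel]
          nlinarith)
      rw [hg]
      rw [hi] at hg1 ⊢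
      -- The distance to `2ℤ` is even and 2-periodic, so `K * |y - 2 * i|` and `K * y` have the same
      -- one; the two signs lead to the nearest even integers `2 * (K * i ± g)`.
      rcases abs_choice (y - 2 * i) with ha | ha
      · refine ⟨K * i + g, ?_⟩
        rw [ha] at hg1 ⊢
        have e : (K : ℝ) * y - 2 * ((K * i + g : ℤ) : ℝ) = K * (y - 2 * i) - 2 * g := by
          push_cast; ring
        rw [e]; exact ⟨rfl, hg1⟩
      · refine ⟨K * i - g, ?_⟩
        rw [ha] at hg1 ⊢
        have e : (K : ℝ) * y - 2 * ((K * i - g : ℤ) : ℝ) = -(K * -(y - 2 * i) - 2 * g) := by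
          push_cast; ring
        rw [e, abs_neg]; exact ⟨rfl, hg1⟩

/-- Dividing by `K ^ s` brings `y` into `[0, 1]`, where the distance to `2ℤ` is the identity; `s`
compositions then undo the scaling. Thus `K ^ s` teeth cost only `s` layers. -/
theorem exists_triangleWave {K : ℕ} (hK : 0 < K) (s : ℕ) (h : Realizable d W D C)
    {y : (Fin d → ℝ) → ℝ} (hy : y ∈ affSpan C) (hW : 2 * (C.length + 1) + K ≤ W) :
    ∃ z, Realizable d W (D + s) (z :: C) ∧ ∀ x, 0 ≤ y x → y x ≤ K ^ s →
      ∃ h : ℤ, z x = |y x - 2 * h| ∧ |y x - 2 * h| ≤ 1 := by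
  obtain ⟨z, hz, hx⟩ := exists_triangleWave_aux hK s (z := fun x => y x / K ^ s)
    (h.of_affSpan (forall_mem_affSpan_cons (affSpan_div_const _ hy) fun _ hg => affSpan_mem hg)) hW
  refine ⟨z, hz, fun x h0 h1 => ?_⟩
  have hK' : (0 : ℝ) < K ^ s := by positivity
  have := hx x (y x / K ^ s) ⟨0, ?_⟩
  · rwa [mul_div_cancel₀ _ hK'.ne'] at this
  · have h2 : 0 ≤ y x / K ^ s := by positivity
    rw [Int.cast_zero, mul_zero, sub_zero, abs_of_nonneg h2]
    exact ⟨rfl, (div_le_one hK').2 h1⟩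

end Realizable

/-! ### Table lookup and digit extraction -/

theorem one_le_abs_natCast_sub {m n : ℕ} (h : m ≠ n) : 1 ≤ |(m : ℝ) - n| := by
  have h1 : (m : ℤ) - n ≠ 0 := sub_ne_zero.2 (by exact_mod_cast h)
  have := Int.one_le_abs h1
  exact_mod_cast this

/-- The number with base `K` digits `a 0, …, a (n - 1)`, the leading digit first. -/
def encodeDigits (K : ℕ) : ℕ → (ℕ → ℕ) → ℕ
  | 0, _ => 0
  | n + 1, a => a 0 * K ^ n + encodeDigits K n fun p => a (p + 1)

theorem encodeDigits_lt {K n : ℕ} {a : ℕ → ℕ} (h : ∀ p < n, a p < K) :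
    encodeDigits K n a < K ^ n := by
  induction n generalizing a with
  | zero => simp [encodeDigits]
  | succ n ih =>
    have h1 := ih (a := fun p => a (p + 1)) fun p hp => h _ (by omega)
    have h2 : a 0 + 1 ≤ K := h 0 (by omega)
    calc encodeDigits K (n + 1) a < a 0 * K ^ n + K ^ n := by simpa [encodeDigits] using h1
      _ = (a 0 + 1) * K ^ n := by ring
      _ ≤ K * K ^ n := Nat.mul_le_mul_right _ h2
      _ = K ^ (n + 1) := by ring

/-- By telescoping, any function of `n` is affine in the unary expansion of `n`, so once the ramps
are available it costs no further layer. -/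
theorem sum_diff_ite (Y : ℕ → ℝ) {K n : ℕ} (h : n ≤ K) :
    Y 0 + ∑ k ∈ Finset.range K, (Y (k + 1) - Y k) * (if k < n then 1 else 0) = Y n := by
  simp only [mul_ite, mul_one, mul_zero]
  rw [← Finset.sum_filter]
  have : (Finset.range K).filter (· < n) = Finset.range n := by
    ext k; simp only [Finset.mem_filter, Finset.mem_range]; omega
  rw [this, Finset.sum_range_sub]; ring

namespace Realizable

variable {d W D : ℕ} {C : List ((Fin d → ℝ) → ℝ)}

/-- Add one slice of a table of nonnegative numbers, with `K ^ 2` entries, to `acc`. -/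
theorem exists_table_slice {K : ℕ} (n : ℕ) {Y : ℕ → ℕ → ℝ} {B : ℝ} (hY : ∀ i j, 0 ≤ Y i j)
    (hB : ∀ i j, Y i j ≤ B) {acc t u v : (Fin d → ℝ) → ℝ}
    (h : Realizable d W D (acc :: t :: u :: v :: C)) (hW : 2 * (C.length + 4) + 3 * K + 1 ≤ W) :
    ∃ acc', Realizable d W (D + 2) (acc' :: t :: u :: v :: C) ∧
      ∀ (x : Fin d → ℝ) (nt nu nv : ℕ), t x = nt → u x = nu → v x = nv → nu < K → nv < K →
        acc' x = acc x + if nt = n then Y nu nv else 0 := by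
  set H : List ((Fin d → ℝ) → ℝ) := ramps K 1 1 u ++ (((List.range K).map
    fun (k : ℕ) x => v x - k) ++ [fun x => t x - n]) with hH
  have h1 := h.step_carry (C' := acc :: t :: u :: v :: C) H ?_ (fun g hg => affSpan_mem hg) ?_
  -- `P j` reads row `u` of column `j`. As the entries lie in `[0, B]` and distinct integers differ
  -- by at least `1`, the penalties make `P j` nonpositive unless `v = j` and `t = n`. So `K` such
  -- units read `K ^ 2` entries.
  · set P : ℕ → (Fin d → ℝ) → ℝ := fun j x => Y 0 j + ∑ k ∈ Finset.range K,
      (Y (k + 1) j - Y k j) * ramp ((u x - (k + 1) * 1) / 1) - B * |v x - j| - B * |t x - n|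
      with hP
    have h2 := h1.step_carry (C' := acc :: t :: u :: v :: C) ((List.range K).map P) ?_
      (fun g hg => mem_affSpan_append_right hg) ?_
    · refine ⟨fun x => acc x + ∑ j ∈ Finset.range K, max 0 (P j x), ?_, ?_⟩
      · refine h2.of_affSpan (forall_mem_affSpan_cons (affSpan_add
          (mem_affSpan_append_right (by simp)) (affSpan_sum _ fun k hk => ?_)) fun g hg =>
            mem_affSpan_append_right (List.mem_cons_of_mem _ hg))
        exact relu_mem_affSpan_map (h := P k)
          (List.mem_map.2 ⟨k, List.mem_range.2 (Finset.mem_range.1 hk), rfl⟩)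
      · intro x nt nu nv ht hu hv hnu hnv
        have hB0 : 0 ≤ B := (hY 0 0).trans (hB 0 0)
        have hPx : ∀ j, P j x = Y nu j - B * |(nv : ℝ) - j| - B * |(nt : ℝ) - n| := by
          intro j
          simp only [hP]
          have hr := ramp_eq_ite (c := 1) (η := 1) (z := u x) (m := nu) one_pos zero_le_one
            (by rw [hu]; simp) (by rw [hu]; simp)
          simp only [hr]
          rw [sum_diff_ite (fun k => Y k j) hnu.le, hv, ht]
        have hzero : ∀ j, (nt ≠ n ∨ nv ≠ j) → max 0 (P j x) = 0 := by
          intro j hj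
          rw [hPx, max_eq_left]
          have a1 := mul_nonneg hB0 (abs_nonneg ((nv : ℝ) - j))
          have a2 := mul_nonneg hB0 (abs_nonneg ((nt : ℝ) - n))
          have a3 := hB nu j
          rcases hj with hj | hj
          · have := mul_le_mul_of_nonneg_left (one_le_abs_natCast_sub hj) hB0
            linarith
          · have := mul_le_mul_of_nonneg_left (one_le_abs_natCast_sub hj) hB0
            linarith
        refine congrArg (acc x + ·) ?_
        rw [Finset.sum_eq_single_of_mem nv (Finset.mem_range.2 hnv)
          fun j _ hj => hzero j (Or.inr hj.symm)]
        split_ifs with hn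
        · rw [hPx, hn, sub_self, sub_self, abs_zero, mul_zero, sub_zero, sub_zero,
            max_eq_right (hY _ _)]
        · exact hzero nv (Or.inl hn)
    · intro g hg
      obtain ⟨j, hj, rfl⟩ := List.mem_map.1 hg
      refine affSpan_sub (affSpan_sub (affSpan_add (affSpan_const _) (affSpan_sum _ fun k hk =>
        affSpan_const_mul _ (ramp_mem_affSpan (K := K) ?_ (Finset.mem_range.1 hk))))
        (affSpan_const_mul _ (abs_mem_affSpan (z := fun x => v x - j) ?_ ?_)))
        (affSpan_const_mul _ (abs_mem_affSpan (z := fun x => t x - n) ?_ ?_))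
      · exact fun h hh => relu_mem_affSpan_map (List.mem_append_left _ hh)
      · exact affSpan_sub (mem_affSpan_append_right (by simp)) (affSpan_const _)
      · refine relu_mem_affSpan_map (h := fun x => v x - j) ?_
        exact List.mem_append_right _ (List.mem_append_left _ (List.mem_map.2 ⟨j, hj, rfl⟩))
      · exact affSpan_sub (mem_affSpan_append_right (by simp)) (affSpan_const _)
      · refine relu_mem_affSpan_map (h := fun x => t x - n) ?_
        exact List.mem_append_right _ (List.mem_append_right _ (by simp))
    · simp; omega
  · intro g hg
    rcases List.mem_append.1 hg with hg | hg
    · exact mem_affSpan_of_mem_ramps (affSpan_mem (by simp)) _ hg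
    rcases List.mem_append.1 hg with hg | hg
    · obtain ⟨j, hj, rfl⟩ := List.mem_map.1 hg
      exact affSpan_sub (affSpan_mem (by simp)) (affSpan_const _)
    · rw [List.mem_singleton.1 hg]
      exact affSpan_sub (affSpan_mem (by simp)) (affSpan_const _)
  · simp [hH, length_ramps]; omega

/-- Look up an entry of a table of nonnegative numbers of size `T × K × K`. -/
theorem exists_table {K : ℕ} (T : ℕ) {Y : ℕ → ℕ → ℕ → ℝ} {B : ℝ} (hY : ∀ n i j, 0 ≤ Y n i j)
    (hB : ∀ n i j, Y n i j ≤ B) {t u v : (Fin d → ℝ) → ℝ}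
    (h : Realizable d W D (t :: u :: v :: C)) (hW : 2 * (C.length + 4) + 3 * K + 1 ≤ W) :
    ∃ acc, Realizable d W (D + 2 * T) (acc :: t :: u :: v :: C) ∧
      ∀ (x : Fin d → ℝ) (nt nu nv : ℕ), t x = nt → u x = nu → v x = nv → nu < K → nv < K →
        acc x = if nt < T then Y nt nu nv else 0 := by
  induction T with
  | zero =>
    refine ⟨fun _ => 0, h.of_affSpan (forall_mem_affSpan_cons (affSpan_const _)
      fun _ hg => affSpan_mem hg), by simp⟩
  | succ T ih =>
    obtain ⟨acc, hacc, hx⟩ := ih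
    obtain ⟨acc', hacc', hx'⟩ := exists_table_slice (K := K) T (hY T) (hB T) hacc hW
    refine ⟨acc', hacc', fun x nt nu nv ht hu hv hnu hnv => ?_⟩
    rw [hx' x nt nu nv ht hu hv hnu hnv, hx x nt nu nv ht hu hv hnu hnv]
    rcases lt_trichotomy nt T with h | h | h
    · rw [if_pos h, if_neg h.ne, if_pos (by omega), add_zero]
    · subst h; simp
    · rw [if_neg (by omega), if_neg (by omega), if_neg (by omega), add_zero]

/-- Split off the leading digit of `rem`; if `l = n`, add the product of that digit, of the weight
`w` and of `v` to `acc`. -/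
theorem exists_digit_step {K : ℕ} (n : ℕ) (w : ℝ) {c B : ℝ} (hc : 1 ≤ c)
    {rem acc l v : (Fin d → ℝ) → ℝ} (h : Realizable d W D (rem :: acc :: l :: v :: C))
    (hW : 2 * (C.length + 4) + 2 * K + 1 ≤ W) :
    ∃ rem' acc', Realizable d W (D + 2) (rem' :: acc' :: l :: v :: C) ∧
      ∀ (x : Fin d → ℝ) (a : ℕ) (ρ : ℝ) (nl : ℕ), a < K → 0 ≤ ρ → ρ ≤ c - 1 →
        rem x = a * c + ρ → l x = nl → |v x| ≤ B →
        rem' x = ρ ∧ acc' x = acc x + if nl = n then w * a * v x else 0 := by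
  set H : List ((Fin d → ℝ) → ℝ) := ramps K c 1 rem ++ [fun x => l x - n] with hH
  set rem' : (Fin d → ℝ) → ℝ := fun x => rem x - c * ∑ k ∈ Finset.range K,
    ramp ((rem x - (k + 1) * c) / 1)
  have hramp : ∀ {C' : List ((Fin d → ℝ) → ℝ)} {k : ℕ}, k < K →
      (fun x => ramp ((rem x - (k + 1) * c) / 1)) ∈
        affSpan ((H.map fun h x => max 0 (h x)) ++ C') := fun hk =>
    ramp_mem_affSpan (K := K) (fun h hh => relu_mem_affSpan_map (List.mem_append_left _ hh)) hk
  have h1 := h.step_carry (C' := rem :: acc :: l :: v :: C) H ?_ (fun g hg => affSpan_mem hg) ?_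
  -- A pair of gates for the positive and negative parts of `v`. Because `|v| ≤ B`, the pair
  -- contributes `v` if `k < a` and `l = n`, and `0` otherwise. Exactly `a` pairs are open when `l =
  -- n`, which makes the product `a * v` exact.
  · set P : ℕ → (Fin d → ℝ) → ℝ := fun k x =>
      v x - B * (1 - ramp ((rem x - (k + 1) * c) / 1)) - B * |l x - n| with hP
    set Q : ℕ → (Fin d → ℝ) → ℝ := fun k x =>
      -v x - B * (1 - ramp ((rem x - (k + 1) * c) / 1)) - B * |l x - n| with hQ
    have habs : (fun x => |l x - n|) ∈
        affSpan ((H.map fun h x => max 0 (h x)) ++ (rem :: acc :: l :: v :: C)) := by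
      refine abs_mem_affSpan (z := fun x => l x - n) ?_ ?_
      · exact affSpan_sub (mem_affSpan_append_right (by simp)) (affSpan_const _)
      · exact relu_mem_affSpan_map (h := fun x => l x - n)
          (List.mem_append_right _ (by simp))
    have h2 := h1.step_carry (C' := rem' :: acc :: l :: v :: C)
      ((List.range K).map P ++ (List.range K).map Q) ?_ ?_ ?_
    · refine ⟨rem', fun x => acc x + w * ∑ k ∈ Finset.range K, (max 0 (P k x) - max 0 (Q k x)),
        h2.of_affSpan ?_, ?_⟩
      · refine forall_mem_affSpan_cons (mem_affSpan_append_right (by simp))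
          (forall_mem_affSpan_cons (affSpan_add (mem_affSpan_append_right (by simp))
          (affSpan_const_mul _ (affSpan_sum _ fun k hk => affSpan_sub ?_ ?_))) ?_)
        · exact relu_mem_affSpan_map (h := P k) (List.mem_append_left _
            (List.mem_map.2 ⟨k, List.mem_range.2 (Finset.mem_range.1 hk), rfl⟩))
        · exact relu_mem_affSpan_map (h := Q k) (List.mem_append_right _
            (List.mem_map.2 ⟨k, List.mem_range.2 (Finset.mem_range.1 hk), rfl⟩))
        · exact fun g hg => mem_affSpan_append_right
            (List.mem_cons_of_mem _ (List.mem_cons_of_mem _ hg))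
      · intro x a ρ nl ha h0 hρ hrem hl hv
        have hr := ramp_eq_ite (c := c) (η := 1) (z := rem x) (m := a) one_pos (by linarith)
            (by rw [hrem]; linarith) (by rw [hrem]; linarith)
        obtain ⟨hv1, hv2⟩ := abs_le.1 hv
        have hB0 : 0 ≤ B := (abs_nonneg _).trans hv
        constructor
        · simp only [rem', hr]
          rw [sum_range_ite_lt ha.le, hrem]; ring
        · simp only [hP, hQ, hr, hl]
          congr 1
          split_ifs with hn
          · rw [mul_assoc, ← sum_range_ite_lt ha.le (v x)]
            congr 1
            refine Finset.sum_congr rfl fun k _ => ?_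
            rw [hn, sub_self, abs_zero]
            split_ifs
            · rcases le_total 0 (v x) with h | h
              · rw [max_eq_right (by linarith), max_eq_left (by linarith)]; ring
              · rw [max_eq_left (by linarith), max_eq_right (by linarith)]; ring
            · rw [max_eq_left (by linarith), max_eq_left (by linarith)]; ring
          · rw [Finset.sum_eq_zero, mul_zero]
            intro k _
            have := mul_le_mul_of_nonneg_left (one_le_abs_natCast_sub hn) hB0
            split_ifs
            · rw [max_eq_left (by linarith), max_eq_left (by linarith)]; ring
            · rw [max_eq_left (by linarith), max_eq_left (by linarith)]; ring
    · intro g hg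
      rcases List.mem_append.1 hg with hg | hg
      · obtain ⟨k, hk, rfl⟩ := List.mem_map.1 hg
        exact affSpan_sub (affSpan_sub (mem_affSpan_append_right (by simp)) (affSpan_const_mul _
          (affSpan_sub (affSpan_const _) (hramp (List.mem_range.1 hk)))))
          (affSpan_const_mul _ habs)
      · obtain ⟨k, hk, rfl⟩ := List.mem_map.1 hg
        exact affSpan_sub (affSpan_sub (affSpan_neg (mem_affSpan_append_right (by simp)))
          (affSpan_const_mul _ (affSpan_sub (affSpan_const _) (hramp (List.mem_range.1 hk)))))
          (affSpan_const_mul _ habs)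
    · refine forall_mem_affSpan_cons (affSpan_sub (mem_affSpan_append_right (by simp))
        (affSpan_const_mul _ (affSpan_sum _ fun k hk => hramp (Finset.mem_range.1 hk)))) ?_
      exact fun g hg => mem_affSpan_append_right (List.mem_cons_of_mem _ hg)
    · simp; omega
  · intro g hg
    rcases List.mem_append.1 hg with hg | hg
    · exact mem_affSpan_of_mem_ramps (affSpan_mem (by simp)) _ hg
    · rw [List.mem_singleton.1 hg]
      exact affSpan_sub (affSpan_mem (by simp)) (affSpan_const _)
  · simp [hH, length_ramps]; omega

/-- Read all digits of `rem`, and add up the weighted digits in the positions selected by `l`,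
multiplied by `v`. -/
theorem exists_digits {K : ℕ} (hK : 0 < K) {B : ℝ} (n : ℕ) (idx : ℕ → ℕ) (w : ℕ → ℝ) {D : ℕ}
    {rem acc l v : (Fin d → ℝ) → ℝ} (h : Realizable d W D (rem :: acc :: l :: v :: C))
    (hW : 2 * (C.length + 4) + 2 * K + 1 ≤ W) :
    ∃ acc', Realizable d W (D + 2 * n) (acc' :: l :: v :: C) ∧
      ∀ (x : Fin d → ℝ) (a : ℕ → ℕ) (nl : ℕ), (∀ p < n, a p < K) → rem x = encodeDigits K n a →
        l x = nl → |v x| ≤ B → acc' x = acc x + ∑ p ∈ Finset.range n,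
          if nl = idx p then w p * a p * v x else 0 := by
  induction n generalizing idx w rem acc D with
  | zero =>
    refine ⟨acc, h.of_affSpan fun g hg => affSpan_mem (List.mem_cons_of_mem _ hg), by simp⟩
  | succ n ih =>
    obtain ⟨rem', acc', h', hx'⟩ := exists_digit_step (K := K) (idx 0) (w 0) (c := (K : ℝ) ^ n)
      (B := B) (one_le_pow₀ (by exact_mod_cast hK)) h hW
    obtain ⟨acc'', h'', hx''⟩ := ih (fun p => idx (p + 1)) (fun p => w (p + 1)) h'
    refine ⟨acc'', by convert h'' using 1; ring, fun x a nl ha hrem hl hv => ?_⟩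
    have hlt := encodeDigits_lt (K := K) (n := n) (a := fun p => a (p + 1))
      fun p hp => ha _ (by omega)
    have hlt' : (encodeDigits K n (fun p => a (p + 1)) : ℝ) + 1 ≤ K ^ n := by exact_mod_cast hlt
    obtain ⟨e1, e2⟩ := hx' x (a 0) (encodeDigits K n fun p => a (p + 1)) nl (ha 0 (by omega))
      (by positivity) (by linarith) (by rw [hrem]; simp [encodeDigits]) hl hv
    rw [hx'' x (fun p => a (p + 1)) nl (fun p hp => ha _ (by omega)) e1 hl hv, e2,
      Finset.sum_range_succ']
    ring

end Realizable

/-! ### Multiplication by a tabulated coefficient -/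

/-- Digit `s` of the `i`-th packed coefficient sits at position `i * e + s`, so selecting the
positions with `p / e = i` isolates that coefficient. -/
theorem sum_range_mul_ite_div {T e : ℕ} (F : ℕ → ℕ → ℝ) {i : ℕ} (hi : i < T) :
    ∑ p ∈ Finset.range (T * e), (if i = p / e then F p (p % e) else 0) =
      ∑ s ∈ Finset.range e, F (i * e + s) s := by
  have key : ∀ T, ∑ p ∈ Finset.range (T * e), (if i = p / e then F p (p % e) else 0) =
      if i < T then ∑ s ∈ Finset.range e, F (i * e + s) s else 0 := by
    intro T
    induction T with
    | zero => simp
    | succ T ih =>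
      rw [Nat.succ_mul, Finset.sum_range_add, ih]
      have : ∑ s ∈ Finset.range e, (if i = (T * e + s) / e then F (T * e + s) ((T * e + s) % e)
          else 0) = if i = T then ∑ s ∈ Finset.range e, F (i * e + s) s else 0 := by
        have e1 : ∀ s ∈ Finset.range e, (if i = (T * e + s) / e then
            F (T * e + s) ((T * e + s) % e) else 0) = if i = T then F (i * e + s) s else 0 := by
          intro s hs
          have hs := Finset.mem_range.1 hs
          have h1 : (T * e + s) / e = T := by
            rw [mul_comm, Nat.mul_add_div (by omega), Nat.div_eq_of_lt hs, add_zero]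
          have h2 : (T * e + s) % e = s := by
            rw [mul_comm, Nat.mul_add_mod, Nat.mod_eq_of_lt hs]
          rw [h1, h2]
          split_ifs with h
          · rw [h]
          · rfl
        rw [Finset.sum_congr rfl e1]
        split_ifs <;> simp
      rw [this]
      rcases lt_trichotomy i T with h | h | h
      · rw [if_pos h, if_neg h.ne, if_pos (by omega), add_zero]
      · subst h; simp
      · rw [if_neg (by omega), if_neg (by omega), if_neg (by omega), add_zero]
  rw [key, if_pos hi]

/-- Expansion in base `K` with `e` digits. -/
theorem exists_digit_expansion {K : ℕ} (hK : 0 < K) (e : ℕ) {c : ℝ} (h₀ : 0 ≤ c) (h₁ : c < 1) :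
    ∃ a : ℕ → ℕ, (∀ s, a s < K) ∧ ∑ s ∈ Finset.range e, ((K : ℝ) ^ (s + 1))⁻¹ * a s ≤ c ∧
      c - ∑ s ∈ Finset.range e, ((K : ℝ) ^ (s + 1))⁻¹ * a s ≤ ((K : ℝ) ^ e)⁻¹ := by
  have hK' : (0 : ℝ) < K := by exact_mod_cast hK
  induction e generalizing c with
  | zero => exact ⟨fun _ => 0, fun _ => hK, by simpa using h₀, by simpa using h₁.le⟩
  | succ e ih =>
    have hKc : 0 ≤ K * c := by positivity
    obtain ⟨a, ha, hac, hac'⟩ := ih (c := K * c - ⌊K * c⌋₊) (sub_nonneg.2 (Nat.floor_le hKc))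
      (by linarith [Nat.lt_floor_add_one (K * c)])
    have e1 : ∑ s ∈ Finset.range e, ((K : ℝ) ^ (s + 1 + 1))⁻¹ * (a s : ℝ) =
        (K : ℝ)⁻¹ * ∑ s ∈ Finset.range e, ((K : ℝ) ^ (s + 1))⁻¹ * a s := by
      rw [Finset.mul_sum]
      refine Finset.sum_congr rfl fun s _ => ?_
      rw [pow_succ _ (s + 1), mul_inv]; ring
    have e2 : c - ((K : ℝ)⁻¹ * ∑ s ∈ Finset.range e, ((K : ℝ) ^ (s + 1))⁻¹ * a s +
        ((K : ℝ) ^ (0 + 1))⁻¹ * ⌊K * c⌋₊) = (K : ℝ)⁻¹ *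
        (K * c - ⌊K * c⌋₊ - ∑ s ∈ Finset.range e, ((K : ℝ) ^ (s + 1))⁻¹ * a s) := by
      field_simp
      ring
    refine ⟨fun s => Nat.casesOn s ⌊K * c⌋₊ a, fun s => ?_, ?_⟩
    · cases s with
      | zero =>
        refine (Nat.floor_lt hKc).2 ?_
        nlinarith
      | succ s => exact ha s
    · rw [Finset.sum_range_succ']
      simp only [e1]
      constructor
      · rw [← sub_nonneg]
        refine (mul_nonneg (inv_pos.2 hK').le (sub_nonneg.2 hac)).trans (le_of_eq e2.symm)
      · refine (le_of_eq e2).trans ?_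
        rw [pow_succ, mul_inv, mul_comm]
        exact mul_le_mul_of_nonneg_right hac' (inv_pos.2 hK').le

/-- Hence `2 * T + 2` rounds of digit removal suffice for every floor below, within a depth of order
`T`. -/
theorem sq_mul_sq_le_pow {K T : ℕ} (hK : 2 ≤ K) : K ^ 2 * T ^ 2 ≤ K ^ (2 * T + 2) := by
  have h1 : T ≤ K ^ T := (Nat.lt_pow_self hK).le
  calc K ^ 2 * T ^ 2 ≤ K ^ 2 * (K ^ T) ^ 2 := by gcongr
    _ = K ^ (2 * T + 2) := by ring

theorem clamp_eq_of_abs_le {a P : ℝ} (h : |a| ≤ P) :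
    max 0 (a + P) - max 0 (a - P) - P = a := by
  obtain ⟨h1, h2⟩ := abs_le.1 h
  rw [max_eq_right (by linarith), max_eq_left (by linarith)]; ring

theorem abs_clamp_le (a : ℝ) {P : ℝ} (hP : 0 ≤ P) :
    |max 0 (a + P) - max 0 (a - P) - P| ≤ P := by
  rw [abs_le]
  rcases le_total 0 (a + P) with h1 | h1 <;> rcases le_total 0 (a - P) with h2 | h2 <;>
    simp only [max_eq_left, max_eq_right, h1, h2] <;> constructor <;> linarith

namespace Realizable

variable {d W D : ℕ} {C : List ((Fin d → ℝ) → ℝ)}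

/-- Clamp `a` to the interval `[-M |v|, M |v|]`. -/
theorem exists_clamp {M : ℝ} (hM : 0 ≤ M) {a v : (Fin d → ℝ) → ℝ}
    (h : Realizable d W D (a :: v :: C)) (hW : 2 * (C.length + 2) + 2 ≤ W) :
    ∃ r, Realizable d W (D + 2) (r :: C) ∧ ∀ x, |r x| ≤ M * |v x| ∧
      (|a x| ≤ M * |v x| → r x = a x) := by
  have h1 : Realizable d W (D + 1) (a :: (fun x => |v x|) :: C) := by
    refine h.step_to [v] (by simp; omega) (fun g hg => affSpan_mem (by simp_all)) ?_
    refine forall_mem_affSpan_cons (mem_affSpan_append_right (by simp))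
      (forall_mem_affSpan_cons (abs_mem_affSpan (mem_affSpan_append_right (by simp))
        (relu_mem_affSpan_map (by simp))) ?_)
    exact fun g hg => mem_affSpan_append_right (List.mem_cons_of_mem _ (List.mem_cons_of_mem _ hg))
  have ha : a ∈ affSpan (a :: (fun x => |v x|) :: C) := affSpan_mem (by simp)
  have hv : (fun x => M * |v x|) ∈ affSpan (a :: (fun x => |v x|) :: C) :=
    affSpan_const_mul M (affSpan_mem (g := fun x => |v x|) (by simp))
  refine ⟨fun x => max 0 (a x + M * |v x|) - max 0 (a x - M * |v x|) - M * |v x|,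
    h1.step_to [fun x => a x + M * |v x|, fun x => a x - M * |v x|] (by simp; omega) ?_ ?_, ?_⟩
  · exact forall_mem_affSpan_cons (affSpan_add ha hv)
      (forall_mem_affSpan_cons (affSpan_sub ha hv) (by simp))
  · refine forall_mem_affSpan_cons (affSpan_sub (affSpan_sub ?_ ?_) ?_) ?_
    · exact relu_mem_affSpan_map (h := fun x => a x + M * |v x|) (by simp)
    · exact relu_mem_affSpan_map (h := fun x => a x - M * |v x|) (by simp)
    · exact affSpan_mono (List.subset_append_right _ _) hv
    · exact fun g hg =>
        mem_affSpan_append_right (List.mem_cons_of_mem _ (List.mem_cons_of_mem _ hg))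
  · exact fun x => ⟨abs_clamp_le _ (by positivity), clamp_eq_of_abs_le⟩

/-- The product of `v` with the entry number `q` of a table of `K ^ 2 * T ^ 2` numbers in
`[-M, M]`, up to the precision given by `e` digits in base `K`. -/
theorem exists_lookup_mul {K T : ℕ} (hK : 2 ≤ K) (hT : 0 < T) (e : ℕ) {M : ℝ} (hM : 0 < M) (B : ℝ)
    {coef : ℕ → ℝ} (hcoef : ∀ q, |coef q| < M) {q v : (Fin d → ℝ) → ℝ}
    (h : Realizable d W D (q :: v :: C)) (hW : 2 * C.length + 3 * K + 13 ≤ W) :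
    ∃ r, Realizable d W (D + (8 * T + 8 + 2 * (T * e))) (r :: C) ∧
      ∀ x, |r x| ≤ M * |v x| ∧ ∀ n : ℕ, n < K ^ 2 * T ^ 2 → q x = n → |v x| ≤ B →
        |r x - coef n * v x| ≤ 2 * M * ((K : ℝ) ^ e)⁻¹ * |v x| := by
  have hK0 : 0 < K := by omega
  have hT1 : (1 : ℝ) ≤ T := by exact_mod_cast hT
  have hK1 : (1 : ℝ) ≤ K := by exact_mod_cast hK0
  -- The coefficients are rescaled from `(-M, M)` to `(0, 1)` to have nonnegative digits; `2 * M *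
  -- acc - M * v` undoes this.
  have hexp : ∀ n, ∃ a : ℕ → ℕ, (∀ s, a s < K) ∧
      ∑ s ∈ Finset.range e, ((K : ℝ) ^ (s + 1))⁻¹ * a s ≤ (coef n + M) / (2 * M) ∧
      (coef n + M) / (2 * M) - ∑ s ∈ Finset.range e, ((K : ℝ) ^ (s + 1))⁻¹ * a s ≤
        ((K : ℝ) ^ e)⁻¹ := by
    intro n
    obtain ⟨h1, h2⟩ := abs_lt.1 (hcoef n)
    refine exists_digit_expansion hK0 e (div_nonneg (by linarith) (by linarith)) ?_
    rw [div_lt_one (by linarith)]; linarith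
  choose a haK hac hac' using hexp
  set s := 2 * T + 2 with hs
  have hpow := sq_mul_sq_le_pow (K := K) (T := T) hK
  rw [← hs] at hpow
  -- Mixed radix: the index is `l + T * (t + T * (i + K * k))` with `l, t < T` and `i, k < K`.
  -- Margin `η = 1` is allowed because the quantities divided are integers.
  obtain ⟨q₁, h₁, hq₁⟩ := h.exists_floor_div (K := K) s (c := T) (η := 1) one_pos hT1
    (y := q) (affSpan_mem (by simp)) (by simp; omega)
  obtain ⟨q₂, h₂, hq₂⟩ := h₁.exists_floor_div (K := K) s (c := T) (η := 1) one_pos hT1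
    (y := q₁) (affSpan_mem (by simp)) (by simp; omega)
  obtain ⟨q₃, h₃, hq₃⟩ := h₂.exists_floor_div (K := K) s (c := K) (η := 1) one_pos hK1
    (y := q₂) (affSpan_mem (by simp)) (by simp; omega)
  have h₄ : Realizable d W (D + s + s + s) ((fun x => q₁ x - T * q₂ x) ::
      (fun x => q₂ x - K * q₃ x) :: q₃ :: (fun x => q x - T * q₁ x) :: v :: C) := by
    refine h₃.of_affSpan ?_
    refine forall_mem_affSpan_cons (affSpan_sub (affSpan_mem (by simp)) (affSpan_const_mul _
      (affSpan_mem (by simp)))) (forall_mem_affSpan_cons (affSpan_sub (affSpan_mem (by simp))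
      (affSpan_const_mul _ (affSpan_mem (by simp)))) (forall_mem_affSpan_cons
      (affSpan_mem (by simp)) (forall_mem_affSpan_cons (affSpan_sub (affSpan_mem (by simp))
      (affSpan_const_mul _ (affSpan_mem (by simp)))) ?_)))
    exact fun g hg => affSpan_mem (by simp_all)
  -- One table entry holds the digits of the `T` coefficients that differ only in `l`: `T * K ^ 2`
  -- entries for `K ^ 2 * T ^ 2` coefficients.
  set A : ℕ → ℕ → ℕ → ℕ → ℕ := fun n i k p => a (p / e + T * (n + T * (i + K * k))) (p % e)
  obtain ⟨m, h₅, hm⟩ := h₄.exists_table (K := K) T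
    (Y := fun n i k => encodeDigits K (T * e) (A n i k)) (B := (K : ℝ) ^ (T * e))
    (fun n i k => by positivity)
    (fun n i k => by exact_mod_cast (encodeDigits_lt fun p _ => haK _ _).le)
    (by simp; omega)
  obtain ⟨acc, h₆, hacc⟩ := exists_digits (C := C) hK0 (B := B) (T * e) (fun p => p / e)
    (fun p => ((K : ℝ) ^ (p % e + 1))⁻¹) (rem := m) (acc := fun _ => 0)
    (l := fun x => q x - T * q₁ x) (v := v) (D := D + s + s + s + 2 * T) (W := W)
    (h₅.of_affSpan (forall_mem_affSpan_cons (affSpan_mem (by simp)) (forall_mem_affSpan_cons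
      (affSpan_const _) (forall_mem_affSpan_cons (affSpan_mem (by simp))
      (forall_mem_affSpan_cons (affSpan_mem (by simp)) fun g hg => affSpan_mem (by simp_all))))))
    (by omega)
  -- At a valid index the clamp changes nothing, since there `acc = S * v` with `0 ≤ S ≤ 1`.
  -- Elsewhere it ensures `|r| ≤ M * |v|`, whatever was read.
  obtain ⟨r, h₇, hr⟩ := exists_clamp (C := C) hM.le (a := fun x => 2 * M * acc x - M * v x)
    (v := v) (h₆.of_affSpan (forall_mem_affSpan_cons (affSpan_sub (affSpan_const_mul _
      (affSpan_mem (by simp))) (affSpan_const_mul _ (affSpan_mem (by simp))))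
      (forall_mem_affSpan_cons (affSpan_mem (by simp)) fun g hg => affSpan_mem (by simp_all))))
    (by omega)
  refine ⟨r, by convert h₇ using 1; omega, fun x => ⟨(hr x).1, fun n hn hq hv => ?_⟩⟩
  have hfloor : ∀ (k c : ℕ), 0 < c → (k / c : ℕ) * (c : ℝ) ≤ k ∧
      (k : ℝ) ≤ (k / c : ℕ) * (c : ℝ) + (c - 1) := by
    intro k c hc
    have h1 := Nat.div_add_mod k c
    have h2 := Nat.mod_lt k hc
    have h3 : (k : ℝ) = (k / c : ℕ) * (c : ℝ) + (k % c : ℕ) := by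
      rw [mul_comm]; exact_mod_cast h1.symm
    have h4 : ((k % c : ℕ) : ℝ) + 1 ≤ c := by exact_mod_cast h2
    have h5 : (0 : ℝ) ≤ (k % c : ℕ) := by positivity
    constructor <;> linarith
  have hmod : ∀ (k c : ℕ), (k : ℝ) - c * (k / c : ℕ) = (k % c : ℕ) := by
    intro k c
    have h1 := Nat.div_add_mod k c
    rw [sub_eq_iff_eq_add']; exact_mod_cast h1.symm
  have e₁ : q₁ x = (n / T : ℕ) := hq₁ x (n / T)
    (((Nat.div_le_self _ _).trans_lt hn).trans_le hpow)
    (by rw [hq]; exact (hfloor n T hT).1) (by rw [hq]; exact (hfloor n T hT).2)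
  have e₂ : q₂ x = (n / T / T : ℕ) := hq₂ x (n / T / T)
    ((((Nat.div_le_self _ _).trans (Nat.div_le_self _ _)).trans_lt hn).trans_le hpow)
    (by rw [e₁]; exact (hfloor (n / T) T hT).1) (by rw [e₁]; exact (hfloor (n / T) T hT).2)
  have e₃ : q₃ x = (n / T / T / K : ℕ) := hq₃ x (n / T / T / K)
    (((((Nat.div_le_self _ _).trans (Nat.div_le_self _ _)).trans (Nat.div_le_self _ _)).trans_lt
      hn).trans_le hpow)
    (by rw [e₂]; exact (hfloor (n / T / T) K hK0).1)
    (by rw [e₂]; exact (hfloor (n / T / T) K hK0).2)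
  have hlt : n / T / T / K < K := by
    rw [Nat.div_div_eq_div_mul, Nat.div_div_eq_div_mul, Nat.div_lt_iff_lt_mul (by positivity)]
    calc n < K ^ 2 * T ^ 2 := hn
      _ = K * (T * (T * K)) := by ring
  have em := hm x (n / T % T) (n / T / T % K) (n / T / T / K)
    (by simp only [e₁, e₂]; exact hmod _ _) (by simp only [e₂, e₃]; exact hmod _ _) e₃
    (Nat.mod_lt _ hK0) hlt
  rw [if_pos (Nat.mod_lt _ hT)] at em
  have hl : q x - T * q₁ x = (n % T : ℕ) := by rw [hq, e₁]; exact hmod _ _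
  have eacc := hacc x _ (n % T) (fun p _ => haK _ _) em hl hv
  rw [sum_range_mul_ite_div (fun p s => ((K : ℝ) ^ (s + 1))⁻¹ *
    (A (n / T % T) (n / T / T % K) (n / T / T / K) p : ℝ) * v x) (Nat.mod_lt _ hT), zero_add] at eacc
  have hA : ∀ s ∈ Finset.range e, ((K : ℝ) ^ (s + 1))⁻¹ *
      (A (n / T % T) (n / T / T % K) (n / T / T / K) (n % T * e + s) : ℝ) * v x =
      ((K : ℝ) ^ (s + 1))⁻¹ * (a n s) * v x := by
    intro s hs
    have hs := Finset.mem_range.1 hs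
    have h1 : (n % T * e + s) / e = n % T := by
      rw [mul_comm, Nat.mul_add_div (by omega), Nat.div_eq_of_lt hs, add_zero]
    have h2 : (n % T * e + s) % e = s := by
      rw [mul_comm, Nat.mul_add_mod, Nat.mod_eq_of_lt hs]
    simp only [A]
    rw [h1, h2, Nat.mod_add_div, Nat.mod_add_div, Nat.mod_add_div]
  rw [Finset.sum_congr rfl hA, ← Finset.sum_mul] at eacc
  set S := ∑ s ∈ Finset.range e, ((K : ℝ) ^ (s + 1))⁻¹ * a n s with hS
  have hSc := hac n
  have hSc' := hac' n
  rw [← hS] at hSc hSc'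
  have hS0 : 0 ≤ S := Finset.sum_nonneg fun s _ => by positivity
  have hS1 : S ≤ 1 := by
    refine hSc.trans ?_
    rw [div_le_one (by linarith)]
    linarith [(abs_lt.1 (hcoef n)).2]
  have hval : |2 * M * acc x - M * v x| ≤ M * |v x| := by
    rw [eacc, show 2 * M * (S * v x) - M * v x = M * ((2 * S - 1) * v x) by ring, abs_mul,
      abs_of_pos hM, abs_mul]
    refine mul_le_mul_of_nonneg_left (mul_le_of_le_one_left (abs_nonneg _) ?_) hM.le
    rw [abs_le]; constructor <;> linarith
  rw [(hr x).2 hval, eacc, show 2 * M * (S * v x) - M * v x - coef n * v x =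
    2 * M * (S - (coef n + M) / (2 * M)) * v x by field_simp; ring, abs_mul, abs_mul,
    abs_of_pos (by linarith : 0 < 2 * M)]
  gcongr
  rw [abs_sub_comm, abs_of_nonneg (by linarith)]
  exact hSc'

end Realizable

/-! ### Products on the cells of a grid -/

namespace Realizable

variable {d W D : ℕ} {C : List ((Fin d → ℝ) → ℝ)}

/-- Compute a family of functions one after the other. -/
theorem exists_forall_fin {s m : ℕ} (P : Fin m → ((Fin d → ℝ) → ℝ) → Prop)
    (h : Realizable d W D C)
    (hP : ∀ i (D' : ℕ) (C' : List ((Fin d → ℝ) → ℝ)), Realizable d W D' C' → C ⊆ C' →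
      C'.length < C.length + m → ∃ f, Realizable d W (D' + s) (f :: C') ∧ P i f) :
    ∃ f : Fin m → (Fin d → ℝ) → ℝ, Realizable d W (D + m * s) (List.ofFn f ++ C) ∧
      ∀ i, P i (f i) := by
  induction m with
  | zero => exact ⟨Fin.elim0, by simpa using h, fun i => i.elim0⟩
  | succ m ih =>
    obtain ⟨f, hf, hPf⟩ := ih (fun i => P i.succ)
      fun i D' C' h' hC hl => hP i.succ D' C' h' hC (by omega)
    obtain ⟨g, hg, hPg⟩ := hP 0 _ _ hf (List.subset_append_right _ _) (by simp; omega)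
    refine ⟨Fin.cons g f, ?_, fun i => ?_⟩
    · rw [List.ofFn_succ]
      simp only [Fin.cons_zero, Fin.cons_succ, List.cons_append]
      convert hg using 1; ring
    · refine Fin.cases ?_ (fun i => ?_) i
      · simpa using hPg
      · simpa using hPf i

/-- Given cell coordinates `y`, the product of a coefficient depending on the cell `⌊y⌋` with a
network applied to the triangle waves of the coordinates. -/
theorem exists_cell_product (hd : 0 < d) {K T G : ℕ} (hK : 2 ≤ K) (hT : 0 < T)
    (hG : G ^ d ≤ K ^ 2 * T ^ 2) (e : ℕ) {M : ℝ} (hM : 0 < M) (B : ℝ)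
    {coef : (Fin d → ℕ) → ℝ} (hcoef : ∀ m, |coef m| < M) (net : ReLUNet d 1) (w : ℝ)
    (h : Realizable d W D C) {y : Fin d → (Fin d → ℝ) → ℝ} (hy : ∀ i, y i ∈ affSpan C)
    (hW : 2 * C.length + 2 * d + 3 * K + net.width + 13 ≤ W) :
    ∃ r, Realizable d W
        (D + (2 * d * (2 * T + 2) + net.depth + (8 * T + 8 + 2 * (T * e)))) (r :: C) ∧
      ∀ x, (∀ i, 0 ≤ y i x ∧ y i x < G) → ∃ z : Fin d → ℝ,
        (∀ i, ∃ h : ℤ, z i = |y i x - 2 * h| ∧ |y i x - 2 * h| ≤ 1) ∧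
        |r x| ≤ M * |net.eval (fun i => w * (z i - 1 / 2)) 0| ∧
        (|net.eval (fun i => w * (z i - 1 / 2)) 0| ≤ B → ∀ m : Fin d → ℕ,
          (∀ i, (m i : ℝ) ≤ y i x ∧ y i x ≤ m i + 3 / 4) →
          |r x - coef m * net.eval (fun i => w * (z i - 1 / 2)) 0| ≤
            2 * M * ((K : ℝ) ^ e)⁻¹ * |net.eval (fun i => w * (z i - 1 / 2)) 0|) := by
  set s := 2 * T + 2 with hs
  have hpow : K ^ 2 * T ^ 2 ≤ K ^ s := sq_mul_sq_le_pow hK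
  have hGs : G ≤ K ^ s := (Nat.le_self_pow hd.ne' G).trans (hG.trans hpow)
  -- With `η = 1/4` the floor is guaranteed on the first three quarters of each cell, which contain
  -- the middle half where the supports lie.
  obtain ⟨f, hf, hfx⟩ := h.exists_forall_fin (s := s) (m := d)
    (fun i f => ∀ (x : Fin d → ℝ) (m : ℕ), m < K ^ s → m * (1 : ℝ) ≤ y i x →
      y i x ≤ m * (1 : ℝ) + (1 - 1 / 4) → f x = m)
    fun i D' C' h' hC hl => h'.exists_floor_div (K := K) s (by norm_num) (by norm_num)
      (affSpan_mono hC (hy i)) (by omega)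
  -- These are the weights of `finFunctionFinEquiv`, whose inverse recovers the cell from its
  -- number.
  set q : (Fin d → ℝ) → ℝ := fun x => ∑ i : Fin d, (G : ℝ) ^ (i : ℕ) * f i x with hq
  have h₁ : Realizable d W (D + d * s) (q :: C) := by
    refine hf.of_affSpan (forall_mem_affSpan_cons (affSpan_sum _ fun i _ => affSpan_const_mul _
      (affSpan_mem ?_)) fun g hg => mem_affSpan_append_right hg)
    exact List.mem_append_left _ ((List.mem_ofFn' _ _).2 ⟨i, rfl⟩)
  obtain ⟨z, hz, hzx⟩ := h₁.exists_forall_fin (s := s) (m := d)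
    (fun i z => ∀ x, 0 ≤ y i x → y i x ≤ (K : ℝ) ^ s →
      ∃ h : ℤ, z x = |y i x - 2 * h| ∧ |y i x - 2 * h| ≤ 1)
    fun i D' C' h' hC hl => h'.exists_triangleWave (K := K) (by omega) s
      (affSpan_mono (List.Subset.trans (List.subset_cons_self _ _) hC) (hy i)) (by
        simp only [List.length_cons] at hl; omega)
  have h₂ : Realizable d W (D + d * s + d * s)
      (List.ofFn (fun i x => w * (z i x - 1 / 2)) ++ (q :: C)) := by
    refine hz.of_affSpan fun g hg => ?_
    rcases List.mem_append.1 hg with hg | hg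
    · obtain ⟨i, rfl⟩ := (List.mem_ofFn' _ _).1 hg
      refine affSpan_const_mul _ (affSpan_sub (affSpan_mem ?_) (affSpan_const _))
      exact List.mem_append_left _ ((List.mem_ofFn' _ _).2 ⟨i, rfl⟩)
    · exact mem_affSpan_append_right hg
  have h₃ := h₂.comp_net net (by simp only [List.length_cons]; omega)
  set v : (Fin d → ℝ) → ℝ := fun x => net.eval (fun i => w * (z i x - 1 / 2)) 0 with hv
  classical
  obtain ⟨r, h₄, hr⟩ := exists_lookup_mul (C := C) hK hT e hM B (q := q) (v := v)
    (coef := fun n => if hn : n < G ^ d then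
      coef fun i => (finFunctionFinEquiv.symm ⟨n, hn⟩ i : ℕ) else 0)
    (fun n => by split_ifs <;> simp [hcoef, hM])
    (h₃.of_affSpan (forall_mem_affSpan_cons (mem_affSpan_append_right (by simp))
      (forall_mem_affSpan_cons (affSpan_mem (by simp [hv])) fun g hg =>
        mem_affSpan_append_right (List.mem_cons_of_mem _ hg)))) (by omega)
  refine ⟨r, by convert h₄ using 1; ring, fun x hyx => ⟨fun i => z i x, fun i => ?_, (hr x).1,
    fun hB m hm => ?_⟩⟩
  · exact hzx i x (hyx i).1 ((hyx i).2.le.trans (by exact_mod_cast hGs))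
  · have hmG : ∀ i, m i < G := fun i => by
      exact_mod_cast (hm i).1.trans_lt (hyx i).2
    have hfm : ∀ i, f i x = m i := fun i => hfx i x (m i) ((hmG i).trans_le hGs)
      (by rw [mul_one]; exact (hm i).1) (by linarith [(hm i).2])
    set E : Fin (G ^ d) := finFunctionFinEquiv fun i => (⟨m i, hmG i⟩ : Fin G) with hE
    have hEval : (E : ℕ) = ∑ i : Fin d, m i * G ^ (i : ℕ) := by
      rw [hE, finFunctionFinEquiv_apply]
    have hqx : q x = (E : ℕ) := by
      rw [hEval, hq]
      push_cast
      exact Finset.sum_congr rfl fun i _ => by rw [hfm, mul_comm]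
    have := (hr x).2 E (E.2.trans_le hG) hqx hB
    rw [dif_pos E.2] at this
    have hsymm : (fun i => (finFunctionFinEquiv.symm (⟨E, E.2⟩ : Fin (G ^ d)) i : ℕ)) = m := by
      funext i
      rw [Fin.eta, hE, Equiv.symm_apply_apply]
    rwa [hsymm] at this

end Realizable

/-! ### The shifts in one residue class, seen on the folded grid -/

section Shifts

variable {d : ℕ}

open Classical in
/-- The coefficient attached to the cell `m`; only even cells carry coefficients. -/
noncomputable def cellCoeff (c : (Fin d → ℤ) → ℝ) (w : ℕ) (κ : Fin d → ℤ) (m : Fin d → ℕ) : ℝ :=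
  if ∀ i, Even (m i) then c fun i => w * ((m i : ℤ) - 2) + κ i else 0

theorem abs_cellCoeff_lt {c : (Fin d → ℤ) → ℝ} {M : ℝ} (hM : 0 < M) (hc : ∀ n, |c n| < M) (w : ℕ)
    (κ : Fin d → ℤ) (m : Fin d → ℕ) : |cellCoeff c w κ m| < M := by
  rw [cellCoeff]
  split_ifs
  · exact hc _
  · simpa using hM

variable {φ : (Fin d → ℝ) → ℝ} {R : ℕ} {κ : Fin d → ℤ} {ξ y z : Fin d → ℝ} {h : Fin d → ℤ}

/-- A shift in the residue class of `κ` is nonzero only in the middle of one even cell. -/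
theorem cell_of_shift_ne_zero (hR : 0 < R) (hφ : ∀ x, φ x ≠ 0 → ∀ i, |x i| ≤ R)
    (hy : ∀ i, y i = (ξ i - κ i) / (4 * R) + 5 / 2)
    (hz : ∀ i, z i = |y i - 2 * h i| ∧ |y i - 2 * h i| ≤ 1) {n : Fin d → ℤ}
    (hn : (fun i => n i % (8 * (R : ℤ))) = κ) (hne : φ (fun i => ξ i - n i) ≠ 0) (i : Fin d) :
    z i = y i - 2 * h i ∧ 1 / 4 ≤ z i ∧ z i ≤ 3 / 4 ∧ n i = κ i + 8 * R * (h i - 1) := by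
  have hR' : (0 : ℝ) < R := by exact_mod_cast hR
  have h1 := hφ _ hne i
  obtain ⟨g, hg⟩ : ∃ g : ℤ, n i = κ i + 8 * R * g :=
    ⟨n i / (8 * R), by rw [← hn]; exact (Int.emod_add_mul_ediv _ _).symm⟩
  have hgR : (n i : ℝ) = κ i + 8 * R * g := by exact_mod_cast hg
  -- The support of the shift by `n` is thus within `1/4` of `2 * g + 5 / 2`, in the middle half of
  -- the even cell `2 * (g + 1)`.
  have hyi : y i = (ξ i - n i) / (4 * R) + 2 * g + 5 / 2 := by
    rw [hy, hgR]; field_simp; ring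
  obtain ⟨h2, h3⟩ := abs_le.1 h1
  have h4 : -(1 / 4) ≤ (ξ i - n i) / (4 * R) := by
    rw [le_div_iff₀ (by positivity)]; linarith
  have h5 : (ξ i - n i) / (4 * R) ≤ 1 / 4 := by
    rw [div_le_iff₀ (by positivity)]; linarith
  obtain ⟨h6, h7⟩ := abs_le.1 (hz i).2
  have hgh : g = h i - 1 := by
    have a1 : (2 * (g + 1 - h i) : ℝ) < 2 := by linarith
    have a2 : (-2 : ℝ) < 2 * (g + 1 - h i) := by linarith
    have a3 : 2 * (g + 1 - h i) < 2 := by exact_mod_cast a1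
    have a4 : -2 < 2 * (g + 1 - h i) := by exact_mod_cast a2
    omega
  have hghR : (g : ℝ) = h i - 1 := by exact_mod_cast hgh
  have hzi : z i = y i - 2 * h i := by
    rw [(hz i).1, abs_of_nonneg]; linarith
  refine ⟨hzi, ?_, ?_, by rw [hg, hgh]⟩ <;> linarith

/-- In units of `4 * R` the support of `φ` has half-width `1/4`, so outside the middle half of a
cell there is nothing to reproduce, and the floors may be wrong there. -/
theorem sum_shifts_eq_zero (hR : 0 < R) (hφ : ∀ x, φ x ≠ 0 → ∀ i, |x i| ≤ R)
    (hy : ∀ i, y i = (ξ i - κ i) / (4 * R) + 5 / 2)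
    (hz : ∀ i, z i = |y i - 2 * h i| ∧ |y i - 2 * h i| ≤ 1) (c : (Fin d → ℤ) →₀ ℝ)
    (hbad : ∃ i, ¬(1 / 4 ≤ z i ∧ z i ≤ 3 / 4)) :
    ∑ n ∈ c.support with (fun i => n i % (8 * (R : ℤ))) = κ, c n * φ (fun i => ξ i - n i) = 0 ∧
      φ (fun i => 4 * R * (z i - 1 / 2)) = 0 := by
  have hR' : (0 : ℝ) < R := by exact_mod_cast hR
  obtain ⟨i, hi⟩ := hbad
  constructor
  · refine Finset.sum_eq_zero fun n hn => ?_
    by_cases hne : φ (fun i => ξ i - n i) = 0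
    · rw [hne, mul_zero]
    · obtain ⟨-, h1, h2, -⟩ := cell_of_shift_ne_zero hR hφ hy hz (Finset.mem_filter.1 hn).2 hne i
      exact absurd ⟨h1, h2⟩ hi
  · by_contra hne
    obtain ⟨h1, h2⟩ := abs_le.1 (hφ _ hne i)
    refine hi ⟨?_, ?_⟩ <;> nlinarith

/-- If all cell indices are even, folding is a translation and only one shift can survive. If some
index is odd, folding yields a reflected copy of `φ` where no shift of the class lives; the
coefficient `0` erases it. -/
theorem sum_shifts_eq_cellCoeff (hR : 0 < R) (hφ : ∀ x, φ x ≠ 0 → ∀ i, |x i| ≤ R)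
    (hy : ∀ i, y i = (ξ i - κ i) / (4 * R) + 5 / 2) (hy0 : ∀ i, 0 ≤ y i)
    (hz : ∀ i, z i = |y i - 2 * h i| ∧ |y i - 2 * h i| ≤ 1) (c : (Fin d → ℤ) →₀ ℝ)
    (hκ : ∀ i, κ i % (8 * (R : ℤ)) = κ i) (hgood : ∀ i, 1 / 4 ≤ z i ∧ z i ≤ 3 / 4) :
    ∃ m : Fin d → ℕ, (∀ i, (m i : ℝ) ≤ y i ∧ y i ≤ m i + 3 / 4) ∧
      ∑ n ∈ c.support with (fun i => n i % (8 * (R : ℤ))) = κ, c n * φ (fun i => ξ i - n i) =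
        cellCoeff c (4 * R) κ m * φ (fun i => 4 * R * (z i - 1 / 2)) := by
  have hR' : (0 : ℝ) < R := by exact_mod_cast hR
  have key : ∀ i, ∃ m : ℕ, ((m : ℝ) ≤ y i ∧ y i ≤ m + 3 / 4) ∧
      ((m : ℤ) = 2 * h i ∧ z i = y i - 2 * h i ∨ (m : ℤ) = 2 * h i - 1 ∧ y i - 2 * h i < 0) := by
    intro i
    obtain ⟨h1, h2⟩ := hgood i
    have h3 := hy0 i
    rcases le_or_gt 0 (y i - 2 * h i) with h0 | h0
    · have hzi : z i = y i - 2 * h i := by rw [(hz i).1, abs_of_nonneg h0]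
      have a1 : (-1 : ℝ) < 2 * h i := by linarith
      have a2 : -1 < 2 * h i := by exact_mod_cast a1
      obtain ⟨m, hm⟩ := Int.eq_ofNat_of_zero_le (a := 2 * h i) (by omega)
      have hmR : (m : ℝ) = 2 * h i := by exact_mod_cast hm.symm
      exact ⟨m, ⟨by linarith, by linarith⟩, Or.inl ⟨hm.symm, hzi⟩⟩
    · have hzi : z i = -(y i - 2 * h i) := by rw [(hz i).1, abs_of_neg h0]
      have a1 : (0 : ℝ) < 2 * h i := by linarith
      have a2 : 0 < 2 * h i := by exact_mod_cast a1
      obtain ⟨m, hm⟩ := Int.eq_ofNat_of_zero_le (a := 2 * h i - 1) (by omega)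
      have hmR : (m : ℝ) = 2 * h i - 1 := by exact_mod_cast hm.symm
      exact ⟨m, ⟨by linarith, by linarith⟩, Or.inr ⟨hm.symm, h0⟩⟩
  choose m hm hmh using key
  refine ⟨m, hm, ?_⟩
  rw [cellCoeff]
  split_ifs with heven
  · have hall : ∀ i, (m i : ℤ) = 2 * h i ∧ z i = y i - 2 * h i := by
      intro i
      rcases hmh i with hi | hi
      · exact hi
      · obtain ⟨k, hk⟩ := heven i
        have := hi.1
        omega
    set n₀ : Fin d → ℤ := fun i => ((4 * R : ℕ) : ℤ) * ((m i : ℤ) - 2) + κ i with hn₀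
    have hn₀' : ∀ i, n₀ i = κ i + 8 * R * (h i - 1) := by
      intro i
      simp only [hn₀, (hall i).1]
      push_cast; ring
    have hr : (fun i => 4 * (R : ℝ) * (z i - 1 / 2)) = fun i => ξ i - n₀ i := by
      funext i
      rw [(hall i).2, hn₀', hy]
      push_cast
      field_simp
      ring
    rw [hr]
    refine Finset.sum_eq_single n₀ (fun n hn hne => ?_) fun hn => ?_
    · by_cases hne' : φ (fun i => ξ i - n i) = 0
      · rw [hne', mul_zero]
      · refine absurd (funext fun i => ?_) hne
        rw [hn₀', (cell_of_shift_ne_zero hR hφ hy hz (Finset.mem_filter.1 hn).2 hne' i).2.2.2]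
    · have hcl : (fun i => n₀ i % (8 * (R : ℤ))) = κ := by
        funext i
        rw [hn₀', Int.add_mul_emod_self_left, hκ]
      have : n₀ ∉ c.support := fun h => hn (Finset.mem_filter.2 ⟨h, hcl⟩)
      rw [Finsupp.notMem_support_iff.1 this, zero_mul]
  · rw [zero_mul]
    refine Finset.sum_eq_zero fun n hn => ?_
    by_cases hne' : φ (fun i => ξ i - n i) = 0
    · rw [hne', mul_zero]
    · refine absurd (fun i => ?_) heven
      obtain ⟨h1, h2, -, -⟩ :=
        cell_of_shift_ne_zero hR hφ hy hz (Finset.mem_filter.1 hn).2 hne' i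
      rcases hmh i with hi | hi
      · exact (Int.even_coe_nat (m i)).1 (hi.1 ▸ even_two_mul _)
      · linarith [hi.2]

end Shifts

/-! ### Networks for elements of the shift space -/

namespace Realizable

variable {d W D : ℕ} {C : List ((Fin d → ℝ) → ℝ)}

/-- Approximation of the shifts of `φ` in the residue class of `κ`. -/
theorem exists_residue_class (hd : 0 < d) {φ : (Fin d → ℝ) → ℝ} {R : ℕ} (hR : 0 < R)
    (hφ : ∀ x, φ x ≠ 0 → ∀ i, |x i| ≤ R) {B : ℝ} (hB : ∀ x, |φ x| ≤ B)
    {K T j : ℕ} (hK : 2 ≤ K) (hT : 0 < T) (hj : (2 ^ (j + 2)) ^ d ≤ K ^ 2 * T ^ 2) (e : ℕ)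
    {M : ℝ} (hM : 0 < M) {c : (Fin d → ℤ) →₀ ℝ} (hc : ∀ n, |c n| < M) {net : ReLUNet d 1}
    {ε : ℝ} (hε : ε ≤ 1) (hnet : ∀ x, |φ x - net.eval x 0| ≤ ε) {κ : Fin d → ℤ}
    (hκ : ∀ i, 0 ≤ κ i ∧ κ i < 8 * R) (h : Realizable d W D C)
    (hC : ∀ i : Fin d, (fun x => x i) ∈ affSpan C)
    (hW : 2 * C.length + 2 * d + 3 * K + net.width + 13 ≤ W) :
    ∃ r, Realizable d W
        (D + (2 * d * (2 * T + 2) + net.depth + (8 * T + 8 + 2 * (T * e)))) (r :: C) ∧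
      ∀ x ∈ Set.Icc (0 : Fin d → ℝ) 1,
        |∑ n ∈ c.support with (fun i => n i % (8 * (R : ℤ))) = κ,
          c n * φ (fun i => 2 ^ j * x i - n i) - r x| ≤
          M * ε + 2 * M * ((K : ℝ) ^ e)⁻¹ * (B + 1) := by
  have hR' : (0 : ℝ) < R := by exact_mod_cast hR
  have hR1 : (1 : ℝ) ≤ R := by exact_mod_cast hR
  have hB0 : 0 ≤ B := (abs_nonneg _).trans (hB 0)
  have hε0 : 0 ≤ ε := (abs_nonneg _).trans (hnet 0)
  -- In `5/2`, the `1/2` centres the supports in their cells and the `2` makes `y` nonnegative, as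
  -- `κ i < 8 * R`. On the cube `y ≤ 2 ^ j + 5 / 2 < 2 ^ (j + 2)`, which bounds the number of cells.
  set y : Fin d → (Fin d → ℝ) → ℝ := fun i x => (2 ^ j * x i - κ i) / (4 * R) + 5 / 2 with hy
  obtain ⟨r, hr, hrx⟩ := h.exists_cell_product hd hK hT hj e hM (B + 1)
    (abs_cellCoeff_lt hM hc (4 * R) κ) net (4 * R) (y := y) (fun i => affSpan_add
      (affSpan_div_const _ (affSpan_sub (affSpan_const_mul _ (hC i)) (affSpan_const _)))
      (affSpan_const _)) hW
  refine ⟨r, hr, fun x hx => ?_⟩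
  have hyx : ∀ i, 0 ≤ y i x ∧ y i x < (2 ^ (j + 2) : ℕ) := by
    intro i
    have h0 : 0 ≤ x i := hx.1 i
    have h1 : x i ≤ 1 := hx.2 i
    have k0 : (0 : ℝ) ≤ κ i := by exact_mod_cast (hκ i).1
    have k1 : (κ i : ℝ) ≤ 8 * R := by exact_mod_cast (hκ i).2.le
    have hp : (1 : ℝ) ≤ 2 ^ j := one_le_pow₀ one_le_two
    have a1 : -2 ≤ (2 ^ j * x i - κ i) / (4 * R) := by
      rw [le_div_iff₀ (by positivity)]
      have : 0 ≤ 2 ^ j * x i := by positivity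
      linarith
    have a2 : (2 ^ j * x i - κ i) / (4 * R) ≤ 2 ^ j := by
      rw [div_le_iff₀ (by positivity)]
      nlinarith
    simp only [hy]
    push_cast
    rw [pow_add]
    constructor <;> linarith
  obtain ⟨z, hz, hrM, hrc⟩ := hrx x hyx
  choose g hg using hz
  set v := net.eval (fun i => 4 * (R : ℝ) * (z i - 1 / 2)) 0 with hv
  have hφv := hnet fun i => 4 * (R : ℝ) * (z i - 1 / 2)
  rw [← hv] at hφv
  have hKe : (0 : ℝ) ≤ ((K : ℝ) ^ e)⁻¹ := by positivity
  -- In the middle of a cell the lookup is correct. Otherwise the target is `0` and `|r| ≤ M * |v| ≤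
  -- M * ε` by the clamp.
  by_cases hgood : ∀ i, 1 / 4 ≤ z i ∧ z i ≤ 3 / 4
  · obtain ⟨m, hm, hsum⟩ := sum_shifts_eq_cellCoeff (φ := φ) (ξ := fun i => 2 ^ j * x i)
      (y := fun i => y i x) (z := z) (h := g) hR hφ (fun i => rfl) (fun i => (hyx i).1) hg c
      (fun i => Int.emod_eq_of_lt (hκ i).1 (hκ i).2) hgood
    rw [hsum]
    set p := φ fun i => 4 * (R : ℝ) * (z i - 1 / 2)
    set a := cellCoeff c (4 * R) κ m
    have hp : |p| ≤ B := hB _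
    have hvB : |v| ≤ B + 1 := by
      have := abs_sub_abs_le_abs_sub v p
      rw [abs_sub_comm] at this
      linarith
    have h1 := hrc hvB m hm
    have h2 : |a| ≤ M := (abs_cellCoeff_lt hM hc (4 * R) κ m).le
    calc |a * p - r x| = |a * (p - v) - (r x - a * v)| := by ring_nf
      _ ≤ |a * (p - v)| + |r x - a * v| := abs_sub _ _
      _ ≤ M * ε + 2 * M * ((K : ℝ) ^ e)⁻¹ * (B + 1) := by
        refine add_le_add ?_ (h1.trans ?_)
        · rw [abs_mul]; exact mul_le_mul h2 hφv (abs_nonneg _) hM.le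
        · gcongr
  · push Not at hgood
    obtain ⟨i, hi⟩ := hgood
    obtain ⟨hsum, hzero⟩ := sum_shifts_eq_zero (φ := φ) (ξ := fun i => 2 ^ j * x i)
      (y := fun i => y i x) (z := z) (h := g) hR hφ (fun i => rfl) hg c
      ⟨i, fun hi' => (hi hi'.1).not_ge hi'.2⟩
    rw [hsum, zero_sub, abs_neg]
    rw [hzero, zero_sub, abs_neg] at hφv
    have : 0 ≤ 2 * M * ((K : ℝ) ^ e)⁻¹ * (B + 1) := by positivity
    have := mul_le_mul_of_nonneg_left hφv hM.le
    linarith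

end Realizable

/-- Approximation of the elements of the shift space by networks, uniformly on the cube. -/
theorem exists_reluClass_approx_shifts {d : ℕ} (hd : 0 < d) {φ : (Fin d → ℝ) → ℝ} {R : ℕ}
    (hR : 0 < R) (hφ : ∀ x, φ x ≠ 0 → ∀ i, |x i| ≤ R) {B : ℝ} (hB : ∀ x, |φ x| ≤ B)
    {K T j : ℕ} (hK : 2 ≤ K) (hT : 0 < T) (hj : (2 ^ (j + 2)) ^ d ≤ K ^ 2 * T ^ 2) (e : ℕ)
    {M : ℝ} (hM : 0 < M) {c : (Fin d → ℤ) →₀ ℝ} (hc : ∀ n, |c n| < M) {net : ReLUNet d 1}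
    {ε : ℝ} (hε : ε ≤ 1) (hnet : ∀ x, |φ x - net.eval x 0| ≤ ε) {W D : ℕ}
    (hW : 4 * d + 3 * K + net.width + 15 ≤ W)
    (hD : (8 * R) ^ d * (2 * d * (2 * T + 2) + net.depth + (8 * T + 8 + 2 * (T * e))) + 2 ≤ D) :
    ∃ g ∈ reluClass d W D, ∀ x ∈ Set.Icc (0 : Fin d → ℝ) 1,
      |(c.sum fun n a => a * φ (fun i => 2 ^ j * x i - (n i : ℝ))) - g x| ≤
        (8 * R : ℝ) ^ d * (M * ε + 2 * M * ((K : ℝ) ^ e)⁻¹ * (B + 1)) := by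
  classical
  set t : Finset (Fin d → ℤ) := Fintype.piFinset fun _ => Finset.Ico 0 (8 * (R : ℤ)) with ht
  have hcard : t.card = (8 * R) ^ d := by
    rw [ht, Fintype.card_piFinset_const, Int.card_Ico]
    congr 1
  set Dc := 2 * d * (2 * T + 2) + net.depth + (8 * T + 8 + 2 * (T * e)) with hDc
  set E := M * ε + 2 * M * ((K : ℝ) ^ e)⁻¹ * (B + 1) with hE
  set F : (Fin d → ℤ) → (Fin d → ℝ) → ℝ := fun κ x =>
    ∑ n ∈ c.support with (fun i => n i % (8 * (R : ℤ))) = κ,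
      c n * φ (fun i => 2 ^ j * x i - n i) with hF
  -- The classes are handled in sequence, carrying the coordinates and the running sum, so their
  -- number multiplies the depth and not the width.
  have key : ∀ s ⊆ t, ∃ g, Realizable d W (1 + s.card * Dc)
      (g :: List.ofFn fun (i : Fin d) (x : Fin d → ℝ) => x i) ∧
      ∀ x ∈ Set.Icc (0 : Fin d → ℝ) 1, |∑ κ ∈ s, F κ x - g x| ≤ s.card * E := by
    intro s
    induction s using Finset.induction_on with
    | empty =>
      refine fun _ => ⟨fun _ => 0, ?_, by simp⟩
      exact (Realizable.coords.mono (by simp)).of_affSpan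
        (forall_mem_affSpan_cons (affSpan_const 0) fun g hg => affSpan_mem hg)
    | insert κ s hκ ih =>
      intro hs
      obtain ⟨g, hg, hgx⟩ := ih ((Finset.subset_insert _ _).trans hs)
      obtain ⟨r, hr, hrx⟩ := hg.exists_residue_class hd hR hφ hB hK hT hj e hM hc hε hnet (κ := κ)
        (fun i => Finset.mem_Ico.1 (Fintype.mem_piFinset.1 (hs (Finset.mem_insert_self _ _)) i))
        (fun i => affSpan_mem (List.mem_cons_of_mem _ ((List.mem_ofFn' _ _).2 ⟨i, rfl⟩)))
        (by simp only [List.length_cons, List.length_ofFn]; omega)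
      rw [Finset.card_insert_of_notMem hκ]
      refine ⟨fun x => r x + g x, ?_, fun x hx => ?_⟩
      · rw [add_mul, one_mul, ← add_assoc]
        exact hr.of_affSpan (forall_mem_affSpan_cons (affSpan_add (affSpan_mem (by simp))
          (affSpan_mem (by simp))) fun f hf =>
            affSpan_mem (List.mem_cons_of_mem _ (List.mem_cons_of_mem _ hf)))
      · rw [Finset.sum_insert hκ]
        calc |F κ x + ∑ κ ∈ s, F κ x - (r x + g x)|
            = |(F κ x - r x) + (∑ κ ∈ s, F κ x - g x)| := by ring_nf
          _ ≤ |F κ x - r x| + |∑ κ ∈ s, F κ x - g x| := abs_add_le _ _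
          _ ≤ E + s.card * E := add_le_add (hrx x hx) (hgx x hx)
          _ = (s.card + 1 : ℕ) * E := by push_cast; ring
  obtain ⟨g, hg, hgx⟩ := key t subset_rfl
  refine ⟨g, ?_, fun x hx => ?_⟩
  · have h1 := ((hg.of_affSpan (C' := [g]) fun f hf => affSpan_mem (by simp_all)).mono
      (D' := D - 1) (by rw [hcard]; omega)).mem_reluClass (by omega)
    rwa [Nat.sub_add_cancel (by omega)] at h1
  · have h1 := hgx x hx
    have h2 : ∑ κ ∈ t, F κ x = c.sum fun n a => a * φ (fun i => 2 ^ j * x i - (n i : ℝ)) := by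
      refine Finset.sum_fiberwise_of_maps_to (fun n _ => Fintype.mem_piFinset.2 fun i =>
        Finset.mem_Ico.2 ⟨Int.emod_nonneg _ (by omega), Int.emod_lt_of_pos _ (by omega)⟩) _
    rw [h2, hcard] at h1
    exact_mod_cast h1

/-! ### Choice of the parameters -/

theorem exists_forall_const_mul_logb_le (c : ℝ) :
    ∃ L₁ : ℕ, ∀ L : ℕ, L₁ ≤ L → c * Real.logb 2 L ≤ L := by
  have h := (Real.isLittleO_log_id_atTop.const_mul_left (c / Real.log 2)).bound one_pos
  obtain ⟨L₁, hL₁⟩ := Filter.eventually_atTop.1 (tendsto_natCast_atTop_atTop.eventually h)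
  refine ⟨L₁, fun L hL => ?_⟩
  have := hL₁ L hL
  simp only [id, one_mul, Real.norm_eq_abs, Nat.abs_cast] at this
  calc c * Real.logb 2 L = c / Real.log 2 * Real.log L := by rw [Real.logb]; ring
    _ ≤ L := (le_abs_self _).trans this

/-- The choice of the sizes of the parts of the network. -/
theorem exists_network_parameters {d : ℕ} (hd : 0 < d) {A : ℕ} (hA : 0 < A) {α : ℝ} (hα : 0 < α)
    (K₁ j₀ : ℕ) : ∃ (c : ℝ) (N₀ : ℕ), 0 < c ∧ ∀ N L : ℕ, N₀ ≤ N → N₀ ≤ L →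
      ∃ K T e L₀ j : ℕ, 2 ≤ K ∧ K₁ ≤ K ∧ K₁ ≤ L₀ ∧ 0 < T ∧ j₀ ≤ j ∧
        4 * d + 4 * K + 15 ≤ N ∧
        A * (2 * d * (2 * T + 2) + L₀ + (8 * T + 8 + 2 * (T * e))) + 2 ≤ L ∧
        (2 ^ (j + 2)) ^ d ≤ K ^ 2 * T ^ 2 ∧ ((K : ℝ) * T) ^ 2 ≤ (2 ^ (j + 3)) ^ d ∧
        ((K : ℝ) ^ e)⁻¹ ≤ ((N : ℝ) * L) ^ (-α) ∧ (N : ℝ) * L ≤ c * (K * L₀) ∧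
        (N : ℝ) * L / (Real.logb 2 N * Real.logb 2 L) ≤ c * (K * T) := by
  have hα' : 0 < 4 * α + 1 := by linarith
  -- Bounding `T`, `1` and `2` by multiples of `T * e`, the depth apart from the networks for `φ` is
  -- at most `b * (T * e) + 2`.
  set b : ℕ := A * (8 * d + 18) with hb
  have hb0 : 0 < b := by positivity
  have hbR : (0 : ℝ) < b := by exact_mod_cast hb0
  obtain ⟨L₁, hL₁⟩ := exists_forall_const_mul_logb_le (4 * b * (4 * α + 1))
  refine ⟨128 * b * (4 * α + 1), max (max 256 (16 * d + 60)) (max (max (8 * (K₁ + 2))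
    (8 * (2 ^ d) ^ (j₀ + 2))) (max L₁ (4 * A * (K₁ + 1)))), by positivity, fun N L hN hL => ?_⟩
  simp only [max_le_iff] at hN hL
  obtain ⟨⟨hN1, hN2⟩, ⟨hN3, hN4⟩, -, -⟩ := hN
  obtain ⟨⟨hL1, -⟩, -, hL2, hL3⟩ := hL
  have hNR : (256 : ℝ) ≤ N := by exact_mod_cast hN1
  have hLR : (256 : ℝ) ≤ L := by exact_mod_cast hL1
  have hlogN : 1 ≤ Real.logb 2 N := by
    rw [Real.le_logb_iff_rpow_le (by norm_num) (by linarith), Real.rpow_one]; linarith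
  have hlogL : 1 ≤ Real.logb 2 L := by
    rw [Real.le_logb_iff_rpow_le (by norm_num) (by linarith), Real.rpow_one]; linarith
  set l := Real.logb 2 L with hl
  -- As `N ≤ 16 * K ≤ K ^ 2`, this gives `K ^ e ≥ N ^ (e / 2) ≥ N ^ (α * (1 + l)) ≥ (N * L) ^ α`.
  set e := ⌈2 * α * (1 + l)⌉₊ with he
  have he1 : 2 * α * (1 + l) ≤ e := Nat.le_ceil _
  have he2 : (e : ℝ) ≤ (4 * α + 1) * l := by
    have : (e : ℝ) < 2 * α * (1 + l) + 1 := Nat.ceil_lt_add_one (by positivity)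
    have h1 := mul_nonneg hα.le (sub_nonneg.2 hlogL)
    linarith
  have he0 : 0 < e := Nat.ceil_pos.2 (by positivity)
  have heu : e * (4 * b) ≤ L := by
    have h1 : (e : ℝ) * (4 * b) ≤ L := by
      refine le_trans ?_ (hL₁ L hL2)
      calc (e : ℝ) * (4 * b) ≤ (4 * α + 1) * l * (4 * b) := by gcongr
        _ = 4 * b * (4 * α + 1) * l := by ring
    exact_mod_cast h1
  -- The lookups and the `A` networks for `φ` each get at most a quarter of the depth: `b * T * e ≤
  -- L / 4` here, `A * L₀ ≤ L / 4` below.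
  set T := L / (4 * b) / e with hT
  have hu : e ≤ L / (4 * b) := (Nat.le_div_iff_mul_le (by positivity)).2 heu
  have hT0 : 0 < T := Nat.div_pos hu he0
  have hTe : T * e * (4 * b) ≤ L :=
    (Nat.mul_le_mul_right _ (Nat.div_mul_le_self _ _)).trans (Nat.div_mul_le_self _ _)
  have hTlow : L ≤ 8 * b * e * T := by
    have h1 : L < 4 * b * (L / (4 * b) + 1) := Nat.lt_mul_div_succ _ (by positivity)
    have h2 : L / (4 * b) < e * (T + 1) := Nat.lt_mul_div_succ _ he0
    have h3 : e * (T + 1) ≤ 2 * (e * T) := by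
      have := Nat.le_mul_of_pos_right e hT0
      rw [mul_add, mul_one]; omega
    calc L ≤ 4 * b * (L / (4 * b) + 1) := h1.le
      _ ≤ 4 * b * (2 * (e * T)) := Nat.mul_le_mul_left _ (by omega)
      _ = 8 * b * e * T := by ring
  set L₀ := L / (4 * A) with hL₀
  have hL₀1 : K₁ + 1 ≤ L₀ := (Nat.le_div_iff_mul_le (by positivity)).2 (by linarith)
  have hL₀2 : L₀ * (4 * A) ≤ L := Nat.div_mul_le_self _ _
  have hL₀3 : L ≤ 8 * A * L₀ := by
    have h1 : L < 4 * A * (L₀ + 1) := Nat.lt_mul_div_succ _ (by positivity)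
    calc L ≤ 4 * A * (L₀ + 1) := h1.le
      _ ≤ 4 * A * (2 * L₀) := Nat.mul_le_mul_left _ (by omega)
      _ = 8 * A * L₀ := by ring
  set K := N / 8 with hK
  have hK8 : N ≤ 16 * K := by omega
  have hKj : (2 ^ d) ^ (j₀ + 2) ≤ K := (Nat.le_div_iff_mul_le (by norm_num)).2 (by linarith)
  have hK0 : 0 < K := by omega
  set X := K ^ 2 * T ^ 2 with hX
  have hKX : K ≤ X := by
    calc K = K * 1 * 1 := by ring
      _ ≤ K * K * T ^ 2 := by gcongr <;> [exact hK0; exact Nat.one_le_pow _ _ hT0]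
      _ = X := by rw [hX]; ring
  have h2d : 1 < 2 ^ d := Nat.one_lt_two_pow hd.ne'
  have hJ : j₀ + 2 ≤ Nat.log (2 ^ d) X := Nat.le_log_of_pow_le h2d (hKj.trans hKX)
  have hX1 : (2 ^ d) ^ Nat.log (2 ^ d) X ≤ X := Nat.pow_log_le_self _ (by positivity)
  have hX2 : X < (2 ^ d) ^ (Nat.log (2 ^ d) X + 1) := Nat.lt_pow_succ_log_self h2d _
  -- `j` is the finest level whose cells still fit in the table; maximality yields the reverse bound
  -- with `j + 3`.
  obtain ⟨j, hj⟩ : ∃ j, Nat.log (2 ^ d) X = j + 2 := ⟨Nat.log (2 ^ d) X - 2, by omega⟩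
  rw [hj] at hJ hX1 hX2
  have hK16 : (N : ℝ) ≤ 16 * K := by exact_mod_cast hK8
  have hKR : (0 : ℝ) < K := by exact_mod_cast hK0
  have hTR : (0 : ℝ) < T := by exact_mod_cast hT0
  have hLT : (L : ℝ) ≤ 8 * b * ((4 * α + 1) * l) * T := by
    calc (L : ℝ) ≤ 8 * b * e * T := by exact_mod_cast hTlow
      _ ≤ _ := by gcongr
  clear_value K T e L₀ X l
  refine ⟨K, T, e, L₀, j, by omega, by omega, by omega, hT0, by omega, by omega, ?_, ?_, ?_, ?_,
    ?_, ?_⟩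
  · have h1 : 1 ≤ T * e := Nat.mul_pos hT0 he0
    have h2 : T ≤ T * e := Nat.le_mul_of_pos_right _ he0
    calc A * (2 * d * (2 * T + 2) + L₀ + (8 * T + 8 + 2 * (T * e))) + 2
        ≤ A * (2 * d * (2 * (T * e) + 2 * (T * e)) + L₀ +
          (8 * (T * e) + 8 * (T * e) + 2 * (T * e))) + 2 := by gcongr <;> omega
      _ = b * (T * e) + A * L₀ + 2 := by rw [hb]; ring
      _ ≤ L := by
        have h3 : 4 * (b * (T * e)) ≤ L := by linarith
        have h4 : 4 * (A * L₀) ≤ L := by linarith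
        omega
  · rw [← pow_mul, mul_comm, pow_mul, ← hX]; exact hX1
  · have : X ≤ (2 ^ (j + 3)) ^ d := by
      rw [← pow_mul, mul_comm, pow_mul]; exact hX2.le
    rw [hX] at this
    rw [mul_pow]; exact_mod_cast this
  · have hNL0 : (0 : ℝ) < N * L := by positivity
    rw [Real.rpow_neg hNL0.le]
    refine inv_anti₀ (by positivity) ?_
    have hNK : (N : ℝ) ≤ (K : ℝ) ^ (2 : ℝ) := by
      have h16 : (16 : ℝ) ≤ K := by linarith
      rw [Real.rpow_two, sq]
      exact hK16.trans (mul_le_mul_of_nonneg_right h16 hKR.le)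
    calc ((N : ℝ) * L) ^ α = (N : ℝ) ^ α * ((2 : ℝ) ^ l) ^ α := by
          rw [Real.mul_rpow (by positivity) (by positivity), hl,
            Real.rpow_logb (by norm_num) (by norm_num) (by positivity)]
      _ ≤ (N : ℝ) ^ α * ((N : ℝ) ^ l) ^ α := by gcongr; linarith
      _ = (N : ℝ) ^ (α * (1 + l)) := by
          rw [← Real.rpow_mul (by positivity), ← Real.rpow_add (by positivity)]
          congr 1; ring
      _ ≤ (N : ℝ) ^ ((e : ℝ) / 2) :=
          Real.rpow_le_rpow_of_exponent_le (by linarith) (by linarith)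
      _ ≤ ((K : ℝ) ^ (2 : ℝ)) ^ ((e : ℝ) / 2) := by gcongr
      _ = (K : ℝ) ^ e := by
          rw [← Real.rpow_mul hKR.le, mul_div_cancel₀ _ (by norm_num), Real.rpow_natCast]
  · have hAb : (A : ℝ) ≤ b := by
      have : A ≤ b := Nat.le_mul_of_pos_right _ (by omega)
      exact_mod_cast this
    have hL8 : (L : ℝ) ≤ 8 * A * L₀ := by exact_mod_cast hL₀3
    calc (N : ℝ) * L ≤ 16 * K * (8 * A * L₀) := by gcongr
      _ ≤ 16 * K * (8 * (b * (4 * α + 1)) * L₀) := by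
        gcongr
        exact hAb.trans (le_mul_of_one_le_right hbR.le (by linarith))
      _ = 128 * b * (4 * α + 1) * (K * L₀) := by ring
  -- The construction loses only the factor `log L`; `log N ≥ 1` is inserted at the end.
  · rw [div_le_iff₀ (by positivity)]
    calc (N : ℝ) * L ≤ 16 * K * (8 * b * ((4 * α + 1) * l) * T) := by gcongr
      _ = 128 * b * (4 * α + 1) * (K * T) * (1 * l) := by ring
      _ ≤ 128 * b * (4 * α + 1) * (K * T) * (Real.logb 2 N * l) := by gcongr

/-! ### From approximation errors to approximants, and the conclusion -/

/-- The factor `2` allows for an infimum that is not attained. The bound holds at every point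
because the exceptional set is open and null, hence empty. -/
theorem exists_net_of_approxError_le {d : ℕ} {φ : (Fin d → ℝ) → ℝ} (hφ : Continuous φ)
    {N L : ℕ} {δ : ℝ} (hδ : 0 < δ)
    (h : approxError φ (reluClass d N L) ∞ volume ≤ ENNReal.ofReal δ) :
    ∃ net : ReLUNet d 1, net.depth ≤ L ∧ net.width ≤ N ∧
      ∀ x, |φ x - net.eval x 0| ≤ 2 * δ := by
  have h1 : approxError φ (reluClass d N L) ∞ volume < ENNReal.ofReal (2 * δ) :=
    h.trans_lt ((ENNReal.ofReal_lt_ofReal_iff (by linarith)).2 (by linarith))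
  simp only [approxError, iInf_lt_iff] at h1
  obtain ⟨g, ⟨net, -, hL, hN, hg⟩, hlt⟩ := h1
  refine ⟨net, hL, hN, fun x => ?_⟩
  have hcont : Continuous g := by
    rw [show g = fun x => net.eval x 0 from funext hg]
    exact (continuous_apply 0).comp net.continuous_eval
  rw [← hg]
  have hae : ∀ᵐ x ∂(volume : Measure (Fin d → ℝ)), |φ x - g x| ≤ 2 * δ := by
    have h2 := enorm_ae_le_eLpNormEssSup (φ - g) (volume : Measure (Fin d → ℝ))
    rw [eLpNorm_exponent_top] at hlt
    filter_upwards [h2] with x hx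
    have h3 := hx.trans hlt.le
    rw [← ofReal_norm, ENNReal.ofReal_le_ofReal_iff (by linarith)] at h3
    exact h3
  have hopen : IsOpen {x | 2 * δ < |φ x - g x|} :=
    isOpen_lt continuous_const (hφ.sub hcont).abs
  have hnull : (volume : Measure (Fin d → ℝ)) {x | 2 * δ < |φ x - g x|} = 0 := by
    simpa only [ae_iff, not_le] using hae
  by_contra hx
  have : x ∈ {x | 2 * δ < |φ x - g x|} := not_le.1 hx
  rw [(hopen.measure_eq_zero_iff _).1 hnull] at this
  exact this

theorem cubeMeasure_univ (d : ℕ) : cubeMeasure d Set.univ = 1 := by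
  simp [cubeMeasure, Real.volume_Icc_pi]

theorem eLpNorm_cubeMeasure_le {d : ℕ} {p : ℝ≥0∞} {u : (Fin d → ℝ) → ℝ} {δ : ℝ}
    (h : ∀ x ∈ Set.Icc (0 : Fin d → ℝ) 1, |u x| ≤ δ) :
    eLpNorm u p (cubeMeasure d) ≤ ENNReal.ofReal δ := by
  have h1 : ∀ᵐ x ∂cubeMeasure d, ‖u x‖ ≤ δ := by
    rw [cubeMeasure, ae_restrict_iff' measurableSet_Icc]
    exact Filter.Eventually.of_forall h
  have := eLpNorm_le_of_ae_bound (p := p) h1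
  rwa [cubeMeasure_univ, ENNReal.one_rpow, one_mul] at this

theorem exists_shift_of_approxError_le {d : ℕ} {φ f : (Fin d → ℝ) → ℝ} {j : ℕ} {M δ : ℝ}
    {p : ℝ≥0∞} {μ : Measure (Fin d → ℝ)} (hδ : 0 < δ)
    (h : approxError f (shiftSpace φ j M) p μ ≤ ENNReal.ofReal δ) :
    ∃ c : (Fin d → ℤ) →₀ ℝ, (∀ n, |c n| < M) ∧ eLpNorm (f - fun x => c.sum fun n a =>
      a * φ (fun i => 2 ^ j * x i - (n i : ℝ))) p μ ≤ ENNReal.ofReal (2 * δ) := by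
  have h1 : approxError f (shiftSpace φ j M) p μ < ENNReal.ofReal (2 * δ) :=
    h.trans_lt ((ENNReal.ofReal_lt_ofReal_iff (by linarith)).2 (by linarith))
  simp only [approxError, iInf_lt_iff] at h1
  obtain ⟨g, ⟨c, hc, hg⟩, hlt⟩ := h1
  refine ⟨c, hc, ?_⟩
  rw [← show g = _ from funext hg]
  exact hlt.le

theorem exists_nat_support_bound {d : ℕ} {φ : (Fin d → ℝ) → ℝ} (hφ : HasCompactSupport φ) :
    ∃ R : ℕ, 0 < R ∧ ∀ x, φ x ≠ 0 → ∀ i, |x i| ≤ R := by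
  obtain ⟨r, hr⟩ := hφ.isCompact.isBounded.exists_norm_le
  obtain ⟨n, hn⟩ := exists_nat_ge r
  refine ⟨n + 1, n.succ_pos, fun x hx i => ?_⟩
  have h1 := hr x (subset_tsupport φ hx)
  have h2 := norm_le_pi_norm x i
  rw [Real.norm_eq_abs] at h2
  push_cast
  linarith

theorem mainTheorem4 (d : ℕ) (hd : 0 < d) (φ : (Fin d → ℝ) → ℝ)
    (hφ : Continuous φ) (hφc : HasCompactSupport φ)
    (α : ℝ) (hα : 0 < α) (hord : ApproxOrderAtLeast φ α)
    (p : ℝ≥0∞) (hp : 1 ≤ p) (M : ℝ) (hM : 0 < M) (β : ℝ) (hβ : 0 < β)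
    (f : (Fin d → ℝ) → ℝ) (hf : MemLp f p (cubeMeasure d))
    (happrox : ∃ C : ℝ, 0 < C ∧ ∃ j₀ : ℕ, ∀ j : ℕ, j₀ ≤ j →
      approxError f (shiftSpace φ j M) p (cubeMeasure d)
        ≤ ENNReal.ofReal (C * (2 : ℝ) ^ (-(β * (j : ℝ))))) :
    IsBigOWidthDepth (fun N L => approxError f (reluClass d N L) p (cubeMeasure d))
      (fun N L => max (((N : ℝ) * (L : ℝ)) ^ (-α))
        (((N : ℝ) * (L : ℝ) / (Real.logb 2 (N : ℝ) * Real.logb 2 (L : ℝ)))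
          ^ (-(2 * β / (d : ℝ))))) := by
  obtain ⟨R, hR, hsupp⟩ := exists_nat_support_bound hφc
  obtain ⟨B, hB⟩ := hφc.exists_bound_of_continuous hφ
  simp only [Real.norm_eq_abs] at hB
  have hB0 : 0 ≤ B := (abs_nonneg _).trans (hB 0)
  obtain ⟨C₁, hC₁, K₂, hK₂, hnet⟩ := hord
  obtain ⟨C₂, hC₂, j₀, hshift⟩ := happrox
  -- From `K ≥ K₃` and `L₀ ≥ 1` it follows that `(K * L₀) ^ α ≥ 2 * C₁`, so the network for `φ` has
  -- error at most `1`.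
  obtain ⟨K₃, hK₃⟩ := exists_nat_ge ((2 * C₁) ^ α⁻¹)
  obtain ⟨c, N₀, hc, hpar⟩ := exists_network_parameters hd (A := (8 * R) ^ d) (by positivity) hα
    (max K₂ K₃) j₀
  set γ := 2 * β / (d : ℝ) with hγ
  have hd' : (0 : ℝ) < d := by exact_mod_cast hd
  have hγ0 : 0 < γ := by positivity
  set E₁ : ℝ := 2 * C₂ * 2 ^ (3 * β) * c ^ γ with hE₁
  set E₂ : ℝ := (8 * R : ℝ) ^ d * (M * (2 * C₁ * c ^ α) + 2 * M * (B + 1)) with hE₂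
  refine ⟨E₁ + E₂, by positivity, max N₀ 4, by positivity, fun N L hN hL => ?_⟩
  obtain ⟨K, T, e, L₀, j, hK, hK₁, hL₀, hT, hj, hWN, hDL, hcell, hcell', hprec, hNL, hlog⟩ :=
    hpar N L ((le_max_left _ _).trans hN) ((le_max_left _ _).trans hL)
  have hN4 : (4 : ℝ) ≤ N := by exact_mod_cast (le_max_right _ _).trans hN
  have hL4 : (4 : ℝ) ≤ L := by exact_mod_cast (le_max_right _ _).trans hL
  have hK0 : (0 : ℝ) < K := by exact_mod_cast (by omega : 0 < K)
  have hT0 : (0 : ℝ) < T := by exact_mod_cast hT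
  have hL₀0 : (1 : ℝ) ≤ L₀ := by exact_mod_cast hK₂.trans_le ((le_max_left _ _).trans hL₀)
  have hNL0 : (0 : ℝ) < N * L := by positivity
  set X := (N : ℝ) * L / (Real.logb 2 N * Real.logb 2 L) with hX
  have hX0 : 0 < X := div_pos hNL0 (mul_pos (Real.logb_pos (by norm_num) (by linarith))
    (Real.logb_pos (by norm_num) (by linarith)))
  set m := max (((N : ℝ) * L) ^ (-α)) (X ^ (-γ)) with hm
  -- the network for `φ`
  have hKL : ((K : ℝ) * L₀) ^ (-α) ≤ c ^ α * ((N : ℝ) * L) ^ (-α) := by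
    have h1 : (N : ℝ) * L / c ≤ K * L₀ := by rw [div_le_iff₀ hc]; linarith
    calc ((K : ℝ) * L₀) ^ (-α) ≤ ((N : ℝ) * L / c) ^ (-α) :=
          Real.rpow_le_rpow_of_nonpos (by positivity) h1 (by linarith)
      _ = c ^ α * ((N : ℝ) * L) ^ (-α) := by
          rw [Real.div_rpow hNL0.le hc.le, Real.rpow_neg hc.le, div_inv_eq_mul, mul_comm]
  obtain ⟨net, hnetL, hnetN, hneteps⟩ := exists_net_of_approxError_le hφ
    (δ := C₁ * ((K : ℝ) * L₀) ^ (-α)) (by positivity)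
    (hnet K L₀ ((le_max_left _ _).trans hK₁) ((le_max_left _ _).trans hL₀))
  have heps : 2 * (C₁ * ((K : ℝ) * L₀) ^ (-α)) ≤ 1 := by
    have h1 : (2 * C₁) ^ α⁻¹ ≤ K * L₀ := by
      have : (K₃ : ℝ) ≤ K := by exact_mod_cast (le_max_right _ _).trans hK₁
      nlinarith
    have h2 : 2 * C₁ ≤ ((K : ℝ) * L₀) ^ α := by
      rw [← Real.rpow_inv_le_iff_of_pos (by positivity) (by positivity) hα]; exact h1
    have h3 : 0 < ((K : ℝ) * L₀) ^ α := by positivity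
    rw [Real.rpow_neg (by positivity), ← mul_assoc, ← div_eq_mul_inv, div_le_one h3]
    exact h2
  -- the element of the shift space
  obtain ⟨a, ha, hfa⟩ := exists_shift_of_approxError_le (by positivity) (hshift j hj)
  obtain ⟨g, hg, hag⟩ := exists_reluClass_approx_shifts hd hR hsupp hB hK hT hcell e hM ha heps
    hneteps (W := N) (D := L) (by omega) (le_trans (by gcongr) hDL)
  -- Raising `(K * T) ^ 2 ≤ 2 ^ (d * (j + 3))` to the power `β / d` gives `(K * T) ^ γ ≤ 2 ^ (β * (j
  -- + 3))`.
  have hpow : (2 : ℝ) ^ (-(β * (j : ℝ))) ≤ 2 ^ (3 * β) * c ^ γ * X ^ (-γ) := by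
    have h1 : X / c ≤ K * T := by rw [div_le_iff₀ hc]; linarith
    have h2 : ((K : ℝ) * T) ^ γ ≤ (2 : ℝ) ^ (β * (j + 3)) := by
      have h3 : (((K : ℝ) * T) ^ 2) ^ (β / d) ≤ ((2 ^ (j + 3)) ^ d) ^ (β / d) :=
        Real.rpow_le_rpow (by positivity) hcell' (by positivity)
      rw [← Real.rpow_natCast, ← Real.rpow_mul (by positivity)] at h3
      have h4 : (((2 : ℝ) ^ (j + 3)) ^ d) ^ (β / d) = 2 ^ (β * (j + 3)) := by
        rw [← pow_mul, ← Real.rpow_natCast, ← Real.rpow_mul (by norm_num)]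
        congr 1
        push_cast
        field_simp
      rw [h4] at h3
      convert h3 using 2
      rw [hγ]; push_cast; ring
    calc (2 : ℝ) ^ (-(β * (j : ℝ))) = 2 ^ (3 * β) * (2 ^ (β * (j + 3)))⁻¹ := by
          rw [← Real.rpow_neg (by norm_num), ← Real.rpow_add (by norm_num)]
          congr 1; ring
      _ ≤ 2 ^ (3 * β) * (((K : ℝ) * T) ^ γ)⁻¹ := by gcongr
      _ ≤ 2 ^ (3 * β) * ((X / c) ^ γ)⁻¹ := by gcongr
      _ = 2 ^ (3 * β) * c ^ γ * X ^ (-γ) := by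
          rw [Real.div_rpow hX0.le hc.le, Real.rpow_neg hX0.le, inv_div]; ring
  have hfmeas : AEStronglyMeasurable f (cubeMeasure d) := hf.1
  set u : (Fin d → ℝ) → ℝ := fun x => a.sum fun n b => b * φ (fun i => 2 ^ j * x i - (n i : ℝ))
    with hu
  have hucont : Continuous u := by
    refine continuous_finsetSum _ fun n _ => continuous_const.mul (hφ.comp ?_)
    exact continuous_pi fun i => (continuous_const.mul (continuous_apply i)).sub continuous_const
  have hgcont : Continuous g := by
    obtain ⟨net', -, -, -, hg'⟩ := hg
    rw [show g = fun x => net'.eval x 0 from funext hg']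
    exact (continuous_apply 0).comp net'.continuous_eval
  have hbound₁ : 2 * (C₂ * (2 : ℝ) ^ (-(β * (j : ℝ)))) ≤ E₁ * m := by
    calc 2 * (C₂ * (2 : ℝ) ^ (-(β * (j : ℝ))))
        ≤ 2 * (C₂ * (2 ^ (3 * β) * c ^ γ * X ^ (-γ))) := by gcongr
      _ = E₁ * X ^ (-γ) := by rw [hE₁]; ring
      _ ≤ E₁ * m := by gcongr; exact le_max_right _ _
  have hbound₂ : (8 * R : ℝ) ^ d * (M * (2 * (C₁ * ((K : ℝ) * L₀) ^ (-α))) +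
      2 * M * ((K : ℝ) ^ e)⁻¹ * (B + 1)) ≤ E₂ * m := by
    calc _ ≤ (8 * R : ℝ) ^ d * (M * (2 * (C₁ * (c ^ α * ((N : ℝ) * L) ^ (-α)))) +
          2 * M * ((N : ℝ) * L) ^ (-α) * (B + 1)) := by gcongr
      _ = E₂ * ((N : ℝ) * L) ^ (-α) := by rw [hE₂]; ring
      _ ≤ E₂ * m := by gcongr; exact le_max_left _ _
  calc approxError f (reluClass d N L) p (cubeMeasure d)
      ≤ eLpNorm (f - g) p (cubeMeasure d) := iInf₂_le g hg
    _ = eLpNorm ((f - u) + (u - g)) p (cubeMeasure d) := by rw [sub_add_sub_cancel]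
    _ ≤ eLpNorm (f - u) p (cubeMeasure d) + eLpNorm (u - g) p (cubeMeasure d) :=
        eLpNorm_add_le (hfmeas.sub hucont.aestronglyMeasurable)
          (hucont.sub hgcont).aestronglyMeasurable hp
    _ ≤ ENNReal.ofReal (E₁ * m) + ENNReal.ofReal (E₂ * m) :=
        add_le_add (hfa.trans (ENNReal.ofReal_le_ofReal hbound₁))
          ((eLpNorm_cubeMeasure_le hag).trans (ENNReal.ofReal_le_ofReal hbound₂))
    _ = ENNReal.ofReal ((E₁ + E₂) * m) := by
        rw [← ENNReal.ofReal_add (by positivity) (by positivity), add_mul]
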